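/- Let $n$ be a natural number and $\hbar>0$; write points of phase space as $z=(x,p)\in\mathbb R^n\times\mathbb R^n=\mathbb R^{2n}$. Let $\operatorname{Sp}(n)$ be the group of real symplectic $2n\times 2n$ matrices $S=\begin{pmatrix}A&B\\C&D\end{pmatrix}$. If $\det B\neq 0$, put $\mathcal A(x,x')=\tfrac12 DB^{-1}x\cdot x-B^{-1}x\cdot x'+\tfrac12B^{-1}Ax'\cdot x'$ and, for an integer $m$ which is even if $\det B^{-1}>0$ and odd if $\det B^{-1}<0$, let $\widehat S_{\mathcal A,m}$ be the unitary operator on $L^2(\mathbb R^n)$ with $$\widehat S_{\mathcal A,m}\psi(x)=\Big(\tfrac1{2\pi\hbar}\Big)^{n/2}i^{m-n/2}\sqrt{|\det B^{-1}|}\int e^{\frac i\hbar\mathcal A(x,x')}\psi(x')\,d^nx'\qquad(\psi\in L^1\cap L^2).$$ The metaplectic group $\operatorname{Mp}(n)$ is the group of unitary operators generated by all $\widehat S_{\mathcal A,m}$, and the projection $\pi_{\operatorname{Mp}}:\operatorname{Mp}(n)\to\operatorname{Sp}(n)$ is the homomorphism sending $\widehat S_{\mathcal A,m}$ to the corresponding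 $S=S_{\mathcal A}$. For $\psi\in L^2(\mathbb R^n)$ put $$W\psi(x,p)=\Big(\tfrac1{2\pi\hbar}\Big)^n\int e^{-\frac i\hbar p\cdot y}\psi(x+\tfrac12y)\overline{\psi(x-\tfrac12y)}\,d^ny,$$ $$\operatorname{Amb}\psi(x,p)=\Big(\tfrac1{2\pi\hbar}\Big)^n\int e^{-\frac i\hbar p\cdot y}\psi(y+\tfrac12x)\overline{\psi(y-\tfrac12x)}\,d^ny .$$ For a symbol $a\in\mathcal S'(\mathbb R^{2n})$ let $\operatorname{Op}_{\mathrm W}(a):\mathcal S(\mathbb R^n)\to\mathcal S'(\mathbb R^n)$ be the continuous operator whose distributional kernel is $$K(x,y)=\Big(\tfrac1{2\pi\hbar}\Big)^n\int e^{\frac i\hbar p\cdot(x-y)}a(\tfrac12(x+y),p)\,d^np ,$$ and let $a\circ S^{-1}(z)=a(S^{-1}z)$, in the sense of distributions. **Theorem (symplectic covariance).** Let $\widehat S\in\operatorname{Mp}(n)$ have projection $\pi_{\operatorname{Mp}}(\widehat S)=S\in\operatorname{Sp}(n)$. (i) For every $\psi\in L^2(\mathbb R^n)$ and every $z\in\mathbb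 R^{2n}$, $$W\psi(Sz)=W(\widehat S^{-1}\psi)(z),\qquad \operatorname{Amb}\psi(Sz)=\operatorname{Amb}(\widehat S^{-1}\psi)(z).$$ (ii) The adjoint $\widehat S^\dagger$ restricts to a continuous operator on $\mathcal S(\mathbb R^n)$, $\widehat S$ extends to a continuous operator on $\mathcal S'(\mathbb R^n)$ (with the weak-$*$ topology), and with these, for every symbol $a\in\mathcal S'(\mathbb R^{2n})$, $$\operatorname{Op}_{\mathrm W}(a\circ S^{-1})=\widehat S\,\operatorname{Op}_{\mathrm W}(a)\,\widehat S^\dagger$$ as operators $\mathcal S(\mathbb R^n)\to\mathcal S'(\mathbb R^n)$. -/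

import Mathlib

noncomputable section
namespace PhaseSpace
open SchwartzMap MeasureTheory Complex
open scoped ContDiff

/-- The configuration space `ℝⁿ`. -/
abbrev Config (n : ℕ) := EuclideanSpace ℝ (Fin n)
/-- The phase space `ℝ²ⁿ = ℝⁿ × ℝⁿ` of points `z = (x, p)`. -/
abbrev Phase (n : ℕ) := Config n × Config n

/-- The bilinear form `((x, y), (x', p')) ↦ y · p'`. -/
def momentumPairing (n : ℕ) : Phase n →L[ℝ] Phase n →L[ℝ] ℝ :=
  (innerSL ℝ : Config n →L[ℝ] Config n →L[ℝ] ℝ).bilinearComp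
    (ContinuousLinearMap.snd ℝ (Config n) (Config n))
    (ContinuousLinearMap.snd ℝ (Config n) (Config n))

theorem momentumPairing_apply (n : ℕ) (u v : Phase n) :
    momentumPairing n u v = inner ℝ u.2 v.2 := rfl

section PartialFourier

variable {n : ℕ} {F : Type} [NormedAddCommGroup F] [NormedSpace ℂ F]

/-- The partial Fourier integral `(x, p) ↦ ∫ e^{i c p·y} f(x, y) dy`. -/
def partialFourier (c : ℝ) (f : 𝓢(Phase n, F)) (z : Phase n) : F :=
  ∫ y : Config n, cexp ((c * inner ℝ z.2 y : ℝ) * I) • f (z.1, y)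

theorem exists_decay (n : ℕ) (F : Type) [NormedAddCommGroup F] [NormedSpace ℂ F] :
    ∃ q : Seminorm ℂ 𝓢(Phase n, F), Continuous q ∧
    ∀ (f : 𝓢(Phase n, F)) (x y : Config n), ‖f (x, y)‖ ≤
      q f * (1 + ‖y‖) ^ (-((volume : Measure (Config n)).integrablePower : ℝ)) := by
  set N := (volume : Measure (Config n)).integrablePower
  refine ⟨(2 ^ N : NNReal) • (Finset.Iic ((N, 0) : ℕ × ℕ)).sup
    (schwartzSeminormFamily ℂ (Phase n) F), ?_, ?_⟩
  · exact (Seminorm.continuous_finsetSup fun i _ ↦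
      (schwartz_withSeminorms ℂ (Phase n) F).continuous_seminorm i).const_smul _
  · intro f x y
    have h := one_add_le_sup_seminorm_apply (𝕜 := ℂ) (m := (N, 0)) le_rfl le_rfl f (x, y)
    rw [norm_iteratedFDeriv_zero] at h
    have hy : 1 + ‖y‖ ≤ 1 + ‖(x, y)‖ := by gcongr; exact le_max_right _ _
    rw [Real.rpow_neg (by positivity), Real.rpow_natCast, ← div_eq_mul_inv,
      le_div_iff₀ (by positivity), mul_comm]
    refine le_trans ?_ h
    gcongr

theorem integrable_slice (f : 𝓢(Phase n, F)) (x : Config n) :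
    Integrable (fun y : Config n ↦ f (x, y)) := by
  obtain ⟨q, -, hq⟩ := exists_decay n F
  refine Integrable.mono' ((Measure.integrable_pow_neg_integrablePower
    (volume : Measure (Config n))).const_mul (q f)) ?_ (Filter.Eventually.of_forall (hq f x))
  exact (f.continuous.comp (by fun_prop)).aestronglyMeasurable

theorem norm_phase (t : ℝ) (v : F) : ‖cexp ((t : ℝ) * I) • v‖ = ‖v‖ := by
  rw [norm_smul, Complex.norm_exp_ofReal_mul_I, one_mul]

theorem integrable_partialFourier (c : ℝ) (f : 𝓢(Phase n, F)) (z : Phase n) :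
    Integrable (fun y : Config n ↦ cexp ((c * inner ℝ z.2 y : ℝ) * I) • f (z.1, y)) := by
  refine (integrable_slice f z.1).mono ?_ (Filter.Eventually.of_forall fun y ↦
    (norm_phase _ _).le)
  have := f.continuous
  exact Continuous.aestronglyMeasurable (by fun_prop)

theorem norm_partialFourier_le (n : ℕ) (F : Type) [NormedAddCommGroup F] [NormedSpace ℂ F]
    (c : ℝ) : ∃ q : Seminorm ℂ 𝓢(Phase n, F), Continuous q ∧
      ∀ (f : 𝓢(Phase n, F)) (z : Phase n), ‖partialFourier c f z‖ ≤ q f := by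
  obtain ⟨q, hqc, hq⟩ := exists_decay n F
  set w : Config n → ℝ := fun y ↦
    (1 + ‖y‖) ^ (-((volume : Measure (Config n)).integrablePower : ℝ))
  have hw : Integrable w := Measure.integrable_pow_neg_integrablePower _
  have hK : 0 ≤ ∫ y, w y := integral_nonneg fun y ↦ by positivity
  refine ⟨(Real.toNNReal (∫ y, w y)) • q, hqc.const_smul _, fun f z ↦ ?_⟩
  calc ‖partialFourier c f z‖ ≤ ∫ y, q f * w y :=
        norm_integral_le_of_norm_le (hw.const_mul _) (Filter.Eventually.of_forall fun y ↦ by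
          rw [norm_phase]; exact hq f z.1 y)
    _ = (∫ y, w y) * q f := by rw [integral_const_mul, mul_comm]
    _ = (Real.toNNReal (∫ y, w y) • q) f := by
      rw [smul_apply, NNReal.smul_def, Real.coe_toNNReal _ hK, smul_eq_mul]

/-- Restriction of a real-linear map on `Phase n` to the first factor. -/
def restrictFst (n : ℕ) (F : Type) [NormedAddCommGroup F] [NormedSpace ℂ F] :
    (Phase n →L[ℝ] F) →L[ℂ] (Phase n →L[ℝ] F) :=
  LinearMap.mkContinuous
    { toFun := fun L ↦ L.comp ((ContinuousLinearMap.inl ℝ (Config n) (Config n)).comp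
        (ContinuousLinearMap.fst ℝ (Config n) (Config n)))
      map_add' := fun _ _ ↦ rfl
      map_smul' := fun _ _ ↦ rfl }
    ‖(ContinuousLinearMap.inl ℝ (Config n) (Config n)).comp
        (ContinuousLinearMap.fst ℝ (Config n) (Config n))‖
    (fun L ↦ by
      rw [mul_comm]
      exact ContinuousLinearMap.opNorm_comp_le L _)

/-- The total derivative of `partialFourier c f` is `partialFourier c` of this function. -/
def partialFourierDeriv (n : ℕ) (F : Type) [NormedAddCommGroup F] [NormedSpace ℂ F] (c : ℝ) :
    𝓢(Phase n, F) →L[ℂ] 𝓢(Phase n, Phase n →L[ℝ] F) :=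
  postcompCLM (restrictFst n F) ∘L fderivCLM ℂ (Phase n) F +
    (c * I : ℂ) • smulRightCLM ℂ F (momentumPairing n)

theorem partialFourierDeriv_apply (c : ℝ) (f : 𝓢(Phase n, F)) (u v : Phase n) :
    partialFourierDeriv n F c f u v =
      fderiv ℝ f u (v.1, 0) + (c * I : ℂ) • (inner ℝ u.2 v.2 : ℝ) • f u := rfl

theorem hasFDerivAt_phase {E : Type} [NormedAddCommGroup E] [NormedSpace ℝ E] (c : ℝ)
    (L : E →L[ℝ] ℝ) (z : E) : HasFDerivAt (fun z : E ↦ cexp ((c * L z : ℝ) * I))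
      (L.smulRight (cexp ((c * L z : ℝ) * I) * (c * I))) z := by
  have h2 := (((Complex.ofRealCLM.hasFDerivAt.comp z L.hasFDerivAt).const_mul (c : ℂ)).mul_const
    I).cexp
  convert h2 using 1
  · ext z; simp
  · ext v; simp; ring

theorem hasFDerivAt_integrand (c : ℝ) (f : 𝓢(Phase n, F)) (y : Config n) (z : Phase n) :
    HasFDerivAt (fun z : Phase n ↦ cexp ((c * inner ℝ z.2 y : ℝ) * I) • f (z.1, y))
      (cexp ((c * inner ℝ z.2 y : ℝ) * I) • partialFourierDeriv n F c f (z.1, y)) z := by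
  have h1 : HasFDerivAt (fun z : Phase n ↦ f (z.1, y))
      ((fderiv ℝ f (z.1, y)).comp ((ContinuousLinearMap.inl ℝ (Config n) (Config n)).comp
      (ContinuousLinearMap.fst ℝ (Config n) (Config n)))) z :=
    (f.hasFDerivAt (z.1, y)).comp z
      ((hasFDerivAt_prodMk_left z.1 y).comp z (hasFDerivAt_fst (𝕜 := ℝ)))
  have h2 : HasFDerivAt (fun z : Phase n ↦ cexp ((c * inner ℝ z.2 y : ℝ) * I))
      ((momentumPairing n (0, y)).smulRight (cexp ((c * inner ℝ z.2 y : ℝ) * I) * (c * I))) z := by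
    have := hasFDerivAt_phase c (momentumPairing n (0, y)) z
    simp only [momentumPairing_apply] at this
    simpa only [real_inner_comm] using this
  refine (h2.smul h1).congr_fderiv ?_
  refine ContinuousLinearMap.ext fun v ↦ ?_
  change cexp ((c * inner ℝ z.2 y : ℝ) * I) • fderiv ℝ f (z.1, y) (v.1, 0) +
    ((inner ℝ y v.2 : ℝ) • (cexp ((c * inner ℝ z.2 y : ℝ) * I) * (c * I))) • f (z.1, y) =
    cexp ((c * inner ℝ z.2 y : ℝ) * I) • (fderiv ℝ f (z.1, y) (v.1, 0) +
      (c * I : ℂ) • (inner ℝ y v.2 : ℝ) • f (z.1, y))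
  rw [smul_add, Complex.real_smul, ← Complex.coe_smul (inner ℝ y v.2), smul_smul, smul_smul]
  congr 2; ring

theorem hasFDerivAt_partialFourier (c : ℝ) (f : 𝓢(Phase n, F)) (z : Phase n) :
    HasFDerivAt (partialFourier c f) (partialFourier c (partialFourierDeriv n F c f) z) z := by
  obtain ⟨q, -, hq⟩ := exists_decay n (Phase n →L[ℝ] F)
  set g := partialFourierDeriv n F c f with hg
  have hb : ∀ (z : Phase n) (y : Config n), ‖cexp ((c * inner ℝ z.2 y : ℝ) * I) • g (z.1, y)‖ ≤
      q g * (1 + ‖y‖) ^ (-((volume : Measure (Config n)).integrablePower : ℝ)) := fun z y ↦ by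
    exact (norm_phase _ (g (z.1, y))).trans_le (hq g z.1 y)
  exact hasFDerivAt_integral_of_dominated_of_fderiv_le (s := Set.univ) (𝕜 := ℝ)
    (F := fun (z : Phase n) (y : Config n) ↦ cexp ((c * inner ℝ z.2 y : ℝ) * I) • f (z.1, y))
    (F' := fun (z : Phase n) (y : Config n) ↦ cexp ((c * inner ℝ z.2 y : ℝ) * I) • g (z.1, y))
    Filter.univ_mem
    (Filter.Eventually.of_forall fun z ↦ (integrable_partialFourier c f z).aestronglyMeasurable)
    (integrable_partialFourier c f z)
    (integrable_partialFourier c g z).aestronglyMeasurable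
    (Filter.Eventually.of_forall fun y z _ ↦ hb z y)
    ((Measure.integrable_pow_neg_integrablePower
      (volume : Measure (Config n))).const_mul (q g))
    (Filter.Eventually.of_forall fun y z _ ↦ hasFDerivAt_integrand c f y z)

theorem contDiff_partialFourier (c : ℝ) (m : ℕ) : ∀ (F : Type) [NormedAddCommGroup F]
    [NormedSpace ℂ F] (f : 𝓢(Phase n, F)), ContDiff ℝ m (partialFourier c f) := by
  induction m with
  | zero =>
    intro F _ _ f
    exact contDiff_zero.2 (continuous_iff_continuousAt.2 fun z ↦
      (hasFDerivAt_partialFourier c f z).continuousAt)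
  | succ m ih =>
    intro F _ _ f
    push_cast
    exact contDiff_succ_iff_hasFDerivAt.2 ⟨_, ih _ _, fun z ↦ hasFDerivAt_partialFourier c f z⟩

/-- Multiplication by `x_j` inside the partial Fourier integral. -/
theorem coord_fst_partialFourier (c : ℝ) (f : 𝓢(Phase n, F)) (z : Phase n) (j : Fin n) :
    partialFourier c (smulLeftCLM F (fun u : Phase n ↦ ((u.1 j : ℝ) : ℂ)) f) z =
      z.1 j • partialFourier c f z := by
  have hg : (fun u : Phase n ↦ ((u.1 j : ℝ) : ℂ)).HasTemperateGrowth :=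
    (Complex.ofRealCLM.comp ((EuclideanSpace.proj j : Config n →L[ℝ] ℝ).comp
      (ContinuousLinearMap.fst ℝ (Config n) (Config n)))).hasTemperateGrowth
  simp only [partialFourier, smulLeftCLM_apply_apply hg]
  rw [← integral_smul]
  congr 1; ext y
  rw [smul_comm, Complex.coe_smul]

theorem coord_snd_partialFourier {c : ℝ} (hc : c ≠ 0) (f : 𝓢(Phase n, F)) (z : Phase n)
    (j : Fin n) :
    partialFourier c ((I / c : ℂ) • (SchwartzMap.evalCLM ℂ (Phase n) F
      ((0, EuclideanSpace.single j 1) : Phase n) ∘L fderivCLM ℂ (Phase n) F) f) z =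
      z.2 j • partialFourier c f z := by
  have hd (y : Config n) : HasFDerivAt (fun y : Config n ↦ cexp ((c * inner ℝ z.2 y : ℝ) * I))
      ((innerSL ℝ z.2).smulRight (cexp ((c * inner ℝ z.2 y : ℝ) * I) * (c * I))) y :=
    hasFDerivAt_phase c (innerSL ℝ z.2) y
  have hf (y : Config n) : HasFDerivAt (fun y : Config n ↦ f (z.1, y))
      ((fderiv ℝ f (z.1, y)).comp (ContinuousLinearMap.inr ℝ (Config n) (Config n))) y :=
    (f.hasFDerivAt (z.1, y)).comp y (hasFDerivAt_prodMk_right z.1 y)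
  set e : Config n := EuclideanSpace.single j 1
  set g : 𝓢(Phase n, F) := (SchwartzMap.evalCLM ℂ (Phase n) F
      ((0, e) : Phase n) ∘L fderivCLM ℂ (Phase n) F) f with hg
  have key := integral_smul_fderiv_eq_neg_fderiv_smul_of_integrable (μ := volume) (𝕜 := ℂ)
    (f := fun y : Config n ↦ cexp ((c * inner ℝ z.2 y : ℝ) * I)) (g := fun y ↦ f (z.1, y)) (v := e)
    ?_ ?_ (integrable_partialFourier c f z) (fun y _ ↦ (hd y).differentiableAt)
    (fun y _ ↦ (hf y).differentiableAt)
  · simp only [(hd _).fderiv, (hf _).fderiv] at key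
    have hz : inner ℝ z.2 e = z.2 j := by simp [e, EuclideanSpace.inner_single_right]
    have e1 : partialFourier c g z =
        -∫ y, (z.2 j * c * I : ℂ) • (cexp ((c * inner ℝ z.2 y : ℝ) * I) • f (z.1, y)) := by
      refine Eq.trans ?_ (key.trans ?_)
      · rfl
      · congr 2; ext y
        simp only [ContinuousLinearMap.smulRight_apply, innerSL_apply_apply, hz, smul_smul,
          Complex.real_smul]
        congr 1; ring
    rw [integral_smul] at e1
    have e2 : partialFourier c ((I / c : ℂ) • g) z = (I / c : ℂ) • partialFourier c g z := by
      simp only [partialFourier, smul_apply]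
      rw [← integral_smul]
      congr 1; ext y; rw [smul_comm]
    rw [e2, e1, smul_neg, smul_smul, ← neg_smul]
    have hc' : (c : ℂ) ≠ 0 := by exact_mod_cast hc
    have : -(I / c * (z.2 j * c * I) : ℂ) = (z.2 j : ℝ) := by
      field_simp; rw [I_sq]; ring
    rw [this]; rfl
  · simp only [(hd _).fderiv]
    refine ((integrable_partialFourier c f z).smul (z.2 j * c * I : ℂ)).congr
      (Filter.Eventually.of_forall fun y ↦ ?_)
    have hz : inner ℝ z.2 e = z.2 j := by simp [e, EuclideanSpace.inner_single_right]
    simp only [ContinuousLinearMap.smulRight_apply, innerSL_apply_apply, hz, smul_smul,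
          Complex.real_smul, Pi.smul_apply]
    congr 1; ring
  · simp only [(hf _).fderiv]
    exact integrable_partialFourier c g z

theorem norm_le_sum_coord (x : Config n) : ‖x‖ ≤ ∑ j, |x j| := by
  calc ‖x‖ = ‖∑ j, x j • EuclideanSpace.single j (1 : ℝ)‖ := by
        congr 1; ext i; simp [Finset.sum_apply, Pi.single_apply]
    _ ≤ ∑ j, ‖x j • EuclideanSpace.single j (1 : ℝ)‖ := norm_sum_le _ _
    _ = ∑ j, |x j| := by simp [norm_smul]

theorem norm_phase_le_sum (z : Phase n) : ‖z‖ ≤ ∑ j, |z.1 j| + ∑ j, |z.2 j| := by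
  have h1 := norm_le_sum_coord z.1
  have h2 := norm_le_sum_coord z.2
  have h3 : 0 ≤ ∑ j, |z.1 j| := Finset.sum_nonneg fun j _ ↦ abs_nonneg _
  have h4 : 0 ≤ ∑ j, |z.2 j| := Finset.sum_nonneg fun j _ ↦ abs_nonneg _
  rw [Prod.norm_def]
  exact max_le (by linarith) (by linarith)

theorem pow_mul_norm_partialFourier_le (F : Type) [NormedAddCommGroup F] [NormedSpace ℂ F]
    {c : ℝ} (hc : c ≠ 0) (k : ℕ) : ∃ q : Seminorm ℂ 𝓢(Phase n, F), Continuous q ∧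
      ∀ (f : 𝓢(Phase n, F)) (z : Phase n), ‖z‖ ^ k * ‖partialFourier c f z‖ ≤ q f := by
  induction k with
  | zero => simpa using norm_partialFourier_le n F c
  | succ k ih =>
    obtain ⟨q, hqc, hq⟩ := ih
    set X : Fin n → 𝓢(Phase n, F) →L[ℂ] 𝓢(Phase n, F) := fun j ↦
      (smulLeftCLM F (fun u : Phase n ↦ ((u.1 j : ℝ) : ℂ)))
    set P : Fin n → 𝓢(Phase n, F) →L[ℂ] 𝓢(Phase n, F) := fun j ↦
      (I / c : ℂ) • (SchwartzMap.evalCLM ℂ (Phase n) F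
      ((0, EuclideanSpace.single j 1) : Phase n) ∘L fderivCLM ℂ (Phase n) F)
    refine ⟨∑ j, q.comp (X j).toLinearMap + ∑ j, q.comp (P j).toLinearMap, ?_, fun f z ↦ ?_⟩
    · refine Continuous.add (Seminorm.continuous_finsetSum fun j _ ↦ ?_)
        (Seminorm.continuous_finsetSum fun j _ ↦ ?_)
      · exact hqc.comp (X j).continuous
      · exact hqc.comp (P j).continuous
    · have hX (j : Fin n) : ‖z‖ ^ k * (|z.1 j| * ‖partialFourier c f z‖) ≤ q (X j f) := by
        refine le_trans (le_of_eq ?_) (hq (X j f) z)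
        rw [← Real.norm_eq_abs, ← norm_smul, ← coord_fst_partialFourier]
      have hP (j : Fin n) : ‖z‖ ^ k * (|z.2 j| * ‖partialFourier c f z‖) ≤ q (P j f) := by
        refine le_trans (le_of_eq ?_) (hq (P j f) z)
        rw [← Real.norm_eq_abs, ← norm_smul, ← coord_snd_partialFourier hc]
        rfl
      calc ‖z‖ ^ (k + 1) * ‖partialFourier c f z‖
          = ‖z‖ ^ k * (‖z‖ * ‖partialFourier c f z‖) := by ring
        _ ≤ ‖z‖ ^ k * ((∑ j, |z.1 j| + ∑ j, |z.2 j|) * ‖partialFourier c f z‖) := by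
            gcongr; exact norm_phase_le_sum z
        _ = ∑ j, ‖z‖ ^ k * (|z.1 j| * ‖partialFourier c f z‖) +
            ∑ j, ‖z‖ ^ k * (|z.2 j| * ‖partialFourier c f z‖) := by
            rw [add_mul, mul_add, Finset.sum_mul, Finset.sum_mul, Finset.mul_sum, Finset.mul_sum]
        _ ≤ ∑ j, q (X j f) + ∑ j, q (P j f) :=
            add_le_add (Finset.sum_le_sum fun j _ ↦ hX j) (Finset.sum_le_sum fun j _ ↦ hP j)
        _ = _ := by simp [sum_apply]

theorem pow_mul_norm_iteratedFDeriv_partialFourier_le {c : ℝ} (hc : c ≠ 0) (k l : ℕ) :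
    ∀ (F : Type) [NormedAddCommGroup F] [NormedSpace ℂ F],
      ∃ q : Seminorm ℂ 𝓢(Phase n, F), Continuous q ∧ ∀ (f : 𝓢(Phase n, F)) (z : Phase n),
        ‖z‖ ^ k * ‖iteratedFDeriv ℝ l (partialFourier c f) z‖ ≤ q f := by
  induction l with
  | zero =>
    intro F _ _
    simpa using pow_mul_norm_partialFourier_le F hc k
  | succ l ih =>
    intro F _ _
    obtain ⟨q, hqc, hq⟩ := ih (Phase n →L[ℝ] F)
    refine ⟨q.comp (partialFourierDeriv n F c).toLinearMap,
      hqc.comp (partialFourierDeriv n F c).continuous, fun f z ↦ ?_⟩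
    have h : fderiv ℝ (partialFourier c f) = partialFourier c (partialFourierDeriv n F c f) :=
      funext fun z ↦ (hasFDerivAt_partialFourier c f z).fderiv
    rw [← norm_iteratedFDeriv_fderiv, h]
    exact hq _ z

/-- The partial Fourier integral as a continuous operator on the Schwartz space of phase space. -/
def partialFourierCLM (n : ℕ) {c : ℝ} (hc : c ≠ 0) : 𝓢(Phase n, ℂ) →L[ℂ] 𝓢(Phase n, ℂ) :=
  SchwartzMap.mkCLM (fun f ↦ partialFourier c f)
    (fun f g z ↦ by
      simp only [partialFourier, add_apply, smul_add]
      exact integral_add (integrable_partialFourier c f z) (integrable_partialFourier c g z))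
    (fun a f z ↦ by
      simp only [partialFourier, smul_apply, RingHom.id_apply]
      rw [← integral_smul]
      congr 1; ext y; rw [smul_comm])
    (fun f ↦ contDiff_infty.2 fun m ↦ contDiff_partialFourier c m ℂ f)
    (fun m ↦ by
      obtain ⟨q, hqc, hq⟩ := pow_mul_norm_iteratedFDeriv_partialFourier_le hc m.1 m.2 ℂ
      obtain ⟨s, C, -, hC⟩ := Seminorm.bound_of_continuous
        (schwartz_withSeminorms ℂ (Phase n) ℂ) q hqc
      exact ⟨s, C, C.2, fun f z ↦ (hq f z).trans (hC f)⟩)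

theorem partialFourierCLM_apply {c : ℝ} (hc : c ≠ 0) (f : 𝓢(Phase n, ℂ)) (z : Phase n) :
    partialFourierCLM n hc f z =
      ∫ y : Config n, cexp ((c * inner ℝ z.2 y : ℝ) * I) • f (z.1, y) := rfl

end PartialFourier

section TensorProduct

variable {n : ℕ}

theorem norm_iteratedFDeriv_comp_proj_le (φ : 𝓢(Config n, ℂ)) (L : Phase n →L[ℝ] Config n)
    (hL : ‖L‖ ≤ 1) (i : ℕ) (z : Phase n) :
    ‖iteratedFDeriv ℝ i (fun u ↦ φ (L u)) z‖ ≤ ‖iteratedFDeriv ℝ i φ (L z)‖ := by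
  have h := L.iteratedFDeriv_comp_right (φ.smooth ⊤) z (i := i) (mod_cast le_top)
  change ‖iteratedFDeriv ℝ i (φ ∘ L) z‖ ≤ _
  rw [h]
  refine (ContinuousMultilinearMap.norm_compContinuousLinearMap_le _ _).trans ?_
  refine mul_le_of_le_one_right (norm_nonneg _) ?_
  simpa using pow_le_one₀ (norm_nonneg _) hL

theorem tensor_bound (φ ψ : 𝓢(Config n, ℂ)) (k l : ℕ) (z : Phase n) :
    ‖z‖ ^ k * ‖iteratedFDeriv ℝ l (fun u : Phase n ↦ φ u.1 * ψ u.2) z‖ ≤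
      (∑ i ∈ Finset.range (l + 1), (l.choose i : ℝ) *
        (SchwartzMap.seminorm ℂ 0 (l - i) ψ + SchwartzMap.seminorm ℂ k (l - i) ψ)) *
      ((Finset.Iic ((k, l) : ℕ × ℕ)).sup (schwartzSeminormFamily ℂ (Config n) ℂ)) φ := by
  set Q := ((Finset.Iic ((k, l) : ℕ × ℕ)).sup (schwartzSeminormFamily ℂ (Config n) ℂ)) φ
  have hQ (k' l' : ℕ) (hk : k' ≤ k) (hl : l' ≤ l) : SchwartzMap.seminorm ℂ k' l' φ ≤ Q :=
    Seminorm.le_def.1 (Finset.le_sup (f := schwartzSeminormFamily ℂ (Config n) ℂ)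
      (Finset.mem_Iic.2 (show (k', l') ≤ (k, l) from ⟨hk, hl⟩))) φ
  have hφ : ContDiff ℝ ∞ (fun u : Phase n ↦ φ u.1) := (φ.smooth ⊤).comp contDiff_fst
  have hψ : ContDiff ℝ ∞ (fun u : Phase n ↦ ψ u.2) := (ψ.smooth ⊤).comp contDiff_snd
  have h := ContinuousLinearMap.norm_iteratedFDeriv_le_of_bilinear_of_le_one
    (ContinuousLinearMap.mul ℝ ℂ) hφ hψ z (n := l) (mod_cast le_top)
    (ContinuousLinearMap.opNorm_mul_le ℝ ℂ)
  have hz : ‖z‖ ^ k ≤ ‖z.1‖ ^ k + ‖z.2‖ ^ k := by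
    rcases le_total ‖z.1‖ ‖z.2‖ with h | h
    · rw [Prod.norm_def, max_eq_right h]; exact le_add_of_nonneg_left (by positivity)
    · rw [Prod.norm_def, max_eq_left h]; exact le_add_of_nonneg_right (by positivity)
  refine (mul_le_mul_of_nonneg_left h (by positivity)).trans ?_
  rw [Finset.mul_sum, Finset.sum_mul]
  refine Finset.sum_le_sum fun i hi ↦ ?_
  have hi' : i ≤ l := Nat.lt_succ_iff.1 (Finset.mem_range.1 hi)
  set a := ‖iteratedFDeriv ℝ i φ z.1‖
  set b := ‖iteratedFDeriv ℝ (l - i) ψ z.2‖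
  have ha : ‖iteratedFDeriv ℝ i (fun u : Phase n ↦ φ u.1) z‖ ≤ a :=
    norm_iteratedFDeriv_comp_proj_le φ (ContinuousLinearMap.fst ℝ (Config n) (Config n))
      (ContinuousLinearMap.norm_fst_le ..) i z
  have hb : ‖iteratedFDeriv ℝ (l - i) (fun u : Phase n ↦ ψ u.2) z‖ ≤ b :=
    norm_iteratedFDeriv_comp_proj_le ψ (ContinuousLinearMap.snd ℝ (Config n) (Config n))
      (ContinuousLinearMap.norm_snd_le ..) (l - i) z
  have h1 : ‖z.1‖ ^ k * a ≤ Q := (le_seminorm ℂ k i φ z.1).trans (hQ k i le_rfl hi')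
  have h2 : a ≤ Q := (norm_iteratedFDeriv_le_seminorm ℂ φ i z.1).trans (hQ 0 i (Nat.zero_le _) hi')
  have h3 : ‖z.2‖ ^ k * b ≤ SchwartzMap.seminorm ℂ k (l - i) ψ := le_seminorm ℂ k (l - i) ψ z.2
  have h4 : b ≤ SchwartzMap.seminorm ℂ 0 (l - i) ψ := norm_iteratedFDeriv_le_seminorm ℂ ψ _ z.2
  have hQ0 : 0 ≤ Q := apply_nonneg _ _
  calc ‖z‖ ^ k * ((l.choose i : ℝ) * ‖iteratedFDeriv ℝ i (fun u : Phase n ↦ φ u.1) z‖ *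
        ‖iteratedFDeriv ℝ (l - i) (fun u : Phase n ↦ ψ u.2) z‖)
      ≤ (‖z.1‖ ^ k + ‖z.2‖ ^ k) * ((l.choose i : ℝ) * a * b) := by gcongr
    _ = (l.choose i : ℝ) * ((‖z.1‖ ^ k * a) * b + a * (‖z.2‖ ^ k * b)) := by ring
    _ ≤ (l.choose i : ℝ) * (Q * SchwartzMap.seminorm ℂ 0 (l - i) ψ +
        Q * SchwartzMap.seminorm ℂ k (l - i) ψ) := by gcongr
    _ = _ := by ring

/-- The tensor product `(x, y) ↦ φ(x) ψ(y)`, as a function of `φ`. -/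
def tensorCLM (ψ : 𝓢(Config n, ℂ)) : 𝓢(Config n, ℂ) →L[ℂ] 𝓢(Phase n, ℂ) :=
  SchwartzMap.mkCLM (fun φ u ↦ φ u.1 * ψ u.2)
    (fun φ₁ φ₂ u ↦ by simp [add_mul])
    (fun c φ u ↦ by simp [mul_assoc])
    (fun φ ↦ ((φ.smooth ⊤).comp contDiff_fst).mul ((ψ.smooth ⊤).comp contDiff_snd))
    (fun m ↦ ⟨Finset.Iic (m.1, m.2), _, Finset.sum_nonneg fun i _ ↦
      mul_nonneg (Nat.cast_nonneg _) (add_nonneg (apply_nonneg _ _) (apply_nonneg _ _)),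
      fun φ z ↦ tensor_bound φ ψ m.1 m.2 z⟩)

theorem tensorCLM_apply (φ ψ : 𝓢(Config n, ℂ)) (u : Phase n) :
    tensorCLM ψ φ u = φ u.1 * ψ u.2 := rfl

/-- Exchange of the two factors of phase space. -/
def swapEquiv (n : ℕ) : Phase n ≃L[ℝ] Phase n :=
  ContinuousLinearEquiv.prodComm ℝ (Config n) (Config n)

theorem tensorCLM_swap (φ ψ : 𝓢(Config n, ℂ)) :
    tensorCLM ψ φ = compCLMOfContinuousLinearEquiv ℂ (swapEquiv n) (tensorCLM φ ψ) := by
  ext u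
  exact mul_comm _ _

end TensorProduct

section Weyl

/-- The change of variables `(q, y) ↦ (q + y/2, q - y/2)`. -/
def midpointEquiv (n : ℕ) : Phase n ≃L[ℝ] Phase n :=
  LinearEquiv.toContinuousLinearEquiv
    { toFun := fun u ↦ (u.1 + (2⁻¹ : ℝ) • u.2, u.1 - (2⁻¹ : ℝ) • u.2)
      map_add' := fun u v ↦ by ext i <;> simp <;> ring
      map_smul' := fun c u ↦ by ext i <;> simp <;> ring
      invFun := fun u ↦ ((2⁻¹ : ℝ) • (u.1 + u.2), u.1 - u.2)
      left_inv := fun u ↦ by ext i <;> simp <;> ring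
      right_inv := fun u ↦ by ext i <;> simp <;> ring }

/-- For a test function `f(x, y)` this is the function on phase space
`(q, p) ↦ (1 / 2πħ)ⁿ ∫ e^{(i/ħ) p·y} f(q + y/2, q - y/2) dy`. It is the transpose of the passage
from a symbol `a` to the kernel `K(x, y) = (1 / 2πħ)ⁿ ∫ e^{(i/ħ) p·(x - y)} a((x + y)/2, p) dp`. -/
def kernelTranspose {n : ℕ} {ħ : ℝ} (hħ : 0 < ħ) : 𝓢(Phase n, ℂ) →L[ℂ] 𝓢(Phase n, ℂ) :=
  (((1 / (2 * Real.pi * ħ)) ^ n : ℝ) : ℂ) •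
    (partialFourierCLM n (c := 1 / ħ) (one_div_ne_zero hħ.ne') ∘L
      compCLMOfContinuousLinearEquiv ℂ (midpointEquiv n))

theorem kernelTranspose_apply {n : ℕ} {ħ : ℝ} (hħ : 0 < ħ) (f : 𝓢(Phase n, ℂ)) (q p : Config n) :
    kernelTranspose hħ f (q, p) = (((1 / (2 * Real.pi * ħ)) ^ n : ℝ) : ℂ) *
      ∫ y : Config n, cexp ((1 / ħ * inner ℝ p y : ℝ) * I) *
        f (q + (2⁻¹ : ℝ) • y, q - (2⁻¹ : ℝ) • y) := rfl

/-- The Schwartz kernel `K(x, y) = (1 / 2πħ)ⁿ ∫ e^{(i/ħ) p·(x - y)} a((x + y)/2, p) dp` of the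
Weyl operator with symbol `a`, in the sense of tempered distributions. -/
def weylKernel {n : ℕ} {ħ : ℝ} (hħ : 0 < ħ) (a : 𝓢'(Phase n, ℂ)) : 𝓢'(Phase n, ℂ) :=
  PointwiseConvergenceCLM.precomp ℂ (kernelTranspose hħ) a

/-- The Weyl operator `Op_W(a) : 𝓢(ℝⁿ) → 𝓢'(ℝⁿ)` with symbol `a ∈ 𝓢'(ℝ²ⁿ)`: the operator with
distributional kernel `weylKernel a`, that is `⟨Op_W(a) ψ, φ⟩ = ⟨K, φ ⊗ ψ⟩`. -/
def weylOp {n : ℕ} {ħ : ℝ} (hħ : 0 < ħ) (a : 𝓢'(Phase n, ℂ)) :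
    𝓢(Config n, ℂ) →L[ℂ] 𝓢'(Config n, ℂ) where
  toFun ψ := PointwiseConvergenceCLM.precomp ℂ (tensorCLM ψ) (weylKernel hħ a)
  map_add' ψ₁ ψ₂ := by
    ext φ
    change weylKernel hħ a (tensorCLM (ψ₁ + ψ₂) φ) =
      weylKernel hħ a (tensorCLM ψ₁ φ) + weylKernel hħ a (tensorCLM ψ₂ φ)
    rw [← map_add]
    congr 1
    ext u
    exact mul_add _ _ _
  map_smul' c ψ := by
    ext φ
    change weylKernel hħ a (tensorCLM (c • ψ) φ) = c • weylKernel hħ a (tensorCLM ψ φ)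
    rw [← map_smul]
    congr 1
    ext u
    exact mul_left_comm _ _ _
  cont := PointwiseConvergenceCLM.continuous_of_continuous_eval fun φ ↦ by
    change Continuous fun ψ ↦ weylKernel hħ a (tensorCLM ψ φ)
    simp only [tensorCLM_swap φ]
    exact (weylKernel hħ a).continuous.comp
      ((compCLMOfContinuousLinearEquiv ℂ (swapEquiv n)).continuous.comp (tensorCLM φ).continuous)

theorem weylOp_apply {n : ℕ} {ħ : ℝ} (hħ : 0 < ħ) (a : 𝓢'(Phase n, ℂ)) (ψ φ : 𝓢(Config n, ℂ)) :
    weylOp hħ a ψ φ = a (kernelTranspose hħ (tensorCLM ψ φ)) := rfl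

/-- The tempered distribution `a ∘ L` for an invertible linear map `L` of phase space:
`⟨a ∘ L, f⟩ = |det L|⁻¹ ⟨a, f ∘ L⁻¹⟩`. -/
def compLinear {n : ℕ} (a : 𝓢'(Phase n, ℂ)) (L : Phase n ≃L[ℝ] Phase n) : 𝓢'(Phase n, ℂ) :=
  ((|LinearMap.det (L.toLinearEquiv : Phase n →ₗ[ℝ] Phase n)|⁻¹ : ℝ) : ℂ) •
    PointwiseConvergenceCLM.precomp ℂ (compCLMOfContinuousLinearEquiv ℂ L.symm) a

end Weyl

section Wigner

/-- The Hilbert space `L²(ℝⁿ)`. -/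
abbrev L2 (n : ℕ) := Lp ℂ 2 (volume : Measure (Config n))

/-- The Wigner function
`Wψ(x, p) = (1 / 2πħ)ⁿ ∫ e^{-(i/ħ) p·y} ψ(x + y/2) ψ*(x - y/2) dy`. -/
def wigner {n : ℕ} (ħ : ℝ) (ψ : L2 n) (z : Phase n) : ℂ :=
  (((1 / (2 * Real.pi * ħ)) ^ n : ℝ) : ℂ) * ∫ y : Config n,
    cexp (-(I / ħ) * (inner ℝ z.2 y : ℝ)) *
      (ψ (z.1 + (2⁻¹ : ℝ) • y) * starRingEnd ℂ (ψ (z.1 - (2⁻¹ : ℝ) • y)))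

/-- The ambiguity function
`Amb ψ(x, p) = (1 / 2πħ)ⁿ ∫ e^{-(i/ħ) p·y} ψ(y + x/2) ψ*(y - x/2) dy`. -/
def ambiguity {n : ℕ} (ħ : ℝ) (ψ : L2 n) (z : Phase n) : ℂ :=
  (((1 / (2 * Real.pi * ħ)) ^ n : ℝ) : ℂ) * ∫ y : Config n,
    cexp (-(I / ħ) * (inner ℝ z.2 y : ℝ)) *
      (ψ (y + (2⁻¹ : ℝ) • z.1) * starRingEnd ℂ (ψ (y - (2⁻¹ : ℝ) • z.1)))

end Wigner

section Symplectic

open Matrix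

/-- The symplectic group `Sp(n)`: the real `2n × 2n` matrices `S` with `S J Sᵀ = J`. The sign convention
for `J` does not matter, and the first summand of `Fin n ⊕ Fin n` indexes `x`, the second `p`. -/
abbrev Sp (n : ℕ) := Matrix.symplecticGroup (Fin n) ℝ

/-- The action `(x, p) ↦ (A x + B p, C x + D p)` of a block matrix on phase space. -/
def blockAct {n : ℕ} (M : Matrix (Fin n ⊕ Fin n) (Fin n ⊕ Fin n) ℝ) (z : Phase n) : Phase n :=
  (WithLp.toLp 2 (M.toBlocks₁₁ *ᵥ z.1.ofLp + M.toBlocks₁₂ *ᵥ z.2.ofLp),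
   WithLp.toLp 2 (M.toBlocks₂₁ *ᵥ z.1.ofLp + M.toBlocks₂₂ *ᵥ z.2.ofLp))

theorem blockAct_one {n : ℕ} (z : Phase n) : blockAct 1 z = z := by
  ext i <;> simp [blockAct, ← Matrix.fromBlocks_one]

theorem blockAct_mul {n : ℕ} (M N : Matrix (Fin n ⊕ Fin n) (Fin n ⊕ Fin n) ℝ) (z : Phase n) :
    blockAct (M * N) z = blockAct M (blockAct N z) := by
  conv_lhs => rw [← M.fromBlocks_toBlocks, ← N.fromBlocks_toBlocks, Matrix.fromBlocks_multiply]
  simp only [blockAct, toBlocks_fromBlocks₁₁, toBlocks_fromBlocks₁₂, toBlocks_fromBlocks₂₁,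
    toBlocks_fromBlocks₂₂, Matrix.add_mulVec, Matrix.mulVec_add, ← Matrix.mulVec_mulVec]
  congr 2 <;> abel

/-- The linear automorphism `z ↦ S z` of phase space defined by `S ∈ Sp(n)`. -/
def spEquiv {n : ℕ} (S : Sp n) : Phase n ≃L[ℝ] Phase n :=
  LinearEquiv.toContinuousLinearEquiv
    { toFun := blockAct S.1
      map_add' := fun u v ↦ by
        ext i <;> simp [blockAct, Matrix.mulVec_add] <;> ring
      map_smul' := fun c u ↦ by
        ext i <;> simp [blockAct, Matrix.mulVec_smul]
      invFun := blockAct (S⁻¹).1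
      left_inv := fun z ↦ by
        rw [← blockAct_mul, ← Submonoid.coe_mul, inv_mul_cancel, Submonoid.coe_one, blockAct_one]
      right_inv := fun z ↦ by
        rw [← blockAct_mul, ← Submonoid.coe_mul, mul_inv_cancel, Submonoid.coe_one, blockAct_one] }

/-- A symplectic matrix with blocks `A, B, C, D` is free if `det B ≠ 0`. -/
def IsFree {n : ℕ} (S : Sp n) : Prop := S.1.toBlocks₁₂.det ≠ 0

/-- The generating function
`𝒜(x, x') = ½ D B⁻¹ x · x - B⁻¹ x · x' + ½ B⁻¹ A x' · x'` of a free symplectic matrix. -/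
def generatingFunction {n : ℕ} (S : Sp n) (x x' : Config n) : ℝ :=
  let A := S.1.toBlocks₁₁
  let B := S.1.toBlocks₁₂
  let D := S.1.toBlocks₂₂
  2⁻¹ * (((D * B⁻¹) *ᵥ x.ofLp) ⬝ᵥ x.ofLp) - (B⁻¹ *ᵥ x.ofLp) ⬝ᵥ x'.ofLp +
    2⁻¹ * (((B⁻¹ * A) *ᵥ x'.ofLp) ⬝ᵥ x'.ofLp)

/-- The integer `m` is an admissible choice of `arg det B⁻¹` (in units of `π`): it is even if
`det B⁻¹ > 0` and odd if `det B⁻¹ < 0`. -/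
def IsMaslovIndex {n : ℕ} (S : Sp n) (m : ℤ) : Prop :=
  (0 < (S.1.toBlocks₁₂)⁻¹.det ∧ Even m) ∨ ((S.1.toBlocks₁₂)⁻¹.det < 0 ∧ Odd m)

/-- The generalized Fourier integral
`(1 / 2πħ)^{n/2} i^{m - n/2} √|det B⁻¹| ∫ e^{(i/ħ) 𝒜(x, x')} ψ(x') dx'`. -/
def generalizedFourier {n : ℕ} (ħ : ℝ) (S : Sp n) (m : ℤ) (ψ : Config n → ℂ) (x : Config n) : ℂ :=
  (((1 / (2 * Real.pi * ħ)) ^ ((n : ℝ) / 2) : ℝ) : ℂ) * I ^ ((m : ℂ) - (n : ℂ) / 2) *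
    ((√|(S.1.toBlocks₁₂)⁻¹.det| : ℝ) : ℂ) *
    ∫ x' : Config n, cexp (I / ħ * (generatingFunction S x x' : ℝ)) * ψ x'

/-- The group of unitary operators on `L²(ℝⁿ)`. -/
abbrev UnitaryOp (n : ℕ) := L2 n ≃ₗᵢ[ℂ] L2 n

/-- `U` is the operator `Ŝ_{𝒜,m}` attached to the free symplectic matrix `S`: the unitary operator
on `L²(ℝⁿ)` given on the dense subspace `L¹ ∩ L²` by the generalized Fourier integral. -/
def IsGeneralizedFourier {n : ℕ} (ħ : ℝ) (S : Sp n) (m : ℤ) (U : UnitaryOp n) : Prop :=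
  IsFree S ∧ IsMaslovIndex S m ∧ ∀ ψ : L2 n, Integrable ψ →
    U ψ =ᵐ[volume] generalizedFourier ħ S m ψ

/-- The metaplectic group `Mp(n)`: the group of unitary operators generated by the operators
`Ŝ_{𝒜,m}`. -/
def Mp (ħ : ℝ) (n : ℕ) : Subgroup (UnitaryOp n) :=
  Subgroup.closure {U | ∃ (S : Sp n) (m : ℤ), IsGeneralizedFourier ħ S m U}

/-- The graph of the covering projection `π : Mp(n) → Sp(n)`, that is of the group homomorphism
determined on the generators by `π(Ŝ_{𝒜,m}) = S_𝒜`: the subgroup of the product group which is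
generated by the pairs `(Ŝ_{𝒜,m}, S_𝒜)`. -/
def projectionGraph (ħ : ℝ) (n : ℕ) : Subgroup (UnitaryOp n × Sp n) :=
  Subgroup.closure {X | ∃ m : ℤ, IsGeneralizedFourier ħ X.2 m X.1}

/-- The metaplectic operator `U` has projection `S`. -/
def HasProjection {ħ : ℝ} {n : ℕ} (U : Mp ħ n) (S : Sp n) : Prop :=
  ((U : UnitaryOp n), S) ∈ projectionGraph ħ n

/-- Every metaplectic operator has a projection. -/
theorem exists_hasProjection {ħ : ℝ} {n : ℕ} (U : Mp ħ n) : ∃ S : Sp n, HasProjection U S := by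
  have h : Mp ħ n = (projectionGraph ħ n).map (MonoidHom.fst (UnitaryOp n) (Sp n)) := by
    rw [projectionGraph, MonoidHom.map_closure, Mp]
    congr 1
    ext V
    constructor
    · rintro ⟨S, m, hm⟩
      exact ⟨(V, S), ⟨m, hm⟩, rfl⟩
    · rintro ⟨⟨V', S⟩, ⟨m, hm⟩, rfl⟩
      exact ⟨S, m, hm⟩
  obtain ⟨⟨V, S⟩, hV, hVU⟩ := Subgroup.mem_map.1 (h.le U.2)
  exact ⟨S, by rw [HasProjection, ← hVU]; exact hV⟩

/-- The value at `U` of any group homomorphism with `π(Ŝ_{𝒜,m}) = S_𝒜` is a projection of `U`. -/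
theorem hasProjection_of_hom {ħ : ℝ} {n : ℕ} (π : Mp ħ n →* Sp n)
    (hπ : ∀ (U : Mp ħ n) (S : Sp n) (m : ℤ), IsGeneralizedFourier ħ S m U.1 → π U = S)
    (U : Mp ħ n) : HasProjection U (π U) := by
  obtain ⟨U, hU⟩ := U
  induction hU using Subgroup.closure_induction with
  | mem V hV =>
    obtain ⟨S, m, hm⟩ := hV
    rw [HasProjection, hπ _ S m hm]
    exact Subgroup.subset_closure ⟨m, hm⟩
  | one =>
    have : π (1 : Mp ħ n) = 1 := map_one π
    exact (congrArg (fun s ↦ ((1 : UnitaryOp n), s) ∈ projectionGraph ħ n) this).mpr (one_mem _)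
  | mul V W hV hW ihV ihW =>
    have : π ((⟨V, hV⟩ : Mp ħ n) * ⟨W, hW⟩) = π ⟨V, hV⟩ * π ⟨W, hW⟩ := map_mul π _ _
    exact (congrArg (fun s ↦ ((V * W : UnitaryOp n), s) ∈ projectionGraph ħ n) this).mpr
      (mul_mem ihV ihW)
  | inv V hV ih =>
    have : π (⟨V, hV⟩ : Mp ħ n)⁻¹ = (π ⟨V, hV⟩)⁻¹ := map_inv π _
    exact (congrArg (fun s ↦ ((V⁻¹ : UnitaryOp n), s) ∈ projectionGraph ħ n) this).mpr
      (inv_mem ih)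

/-- A metaplectic operator as a bounded operator on `L²(ℝⁿ)`. -/
def metaplecticCLM {ħ : ℝ} {n : ℕ} (U : Mp ħ n) : L2 n →L[ℂ] L2 n :=
  (U : UnitaryOp n).toContinuousLinearEquiv.toContinuousLinearMap

/-- The operator `T` on the Schwartz space is the restriction of the operator `U` on `L²(ℝⁿ)`. -/
def IsSchwartzRestriction {n : ℕ} (U : L2 n →L[ℂ] L2 n)
    (T : 𝓢(Config n, ℂ) →L[ℂ] 𝓢(Config n, ℂ)) : Prop :=
  ∀ φ : 𝓢(Config n, ℂ), (T φ).toLp 2 = U (φ.toLp 2)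

/-- The operator `T` on the tempered distributions is the continuous extension of the
operator `U` on `L²(ℝⁿ)`; it is unique since `L²(ℝⁿ)` is dense in `𝓢'(ℝⁿ)`. -/
def IsTemperedExtension {n : ℕ} (U : L2 n →L[ℂ] L2 n)
    (T : 𝓢'(Config n, ℂ) →L[ℂ] 𝓢'(Config n, ℂ)) : Prop :=
  ∀ u : L2 n, T (Lp.toTemperedDistribution u) = Lp.toTemperedDistribution (U u)

end Symplectic

end PhaseSpace

end

open PhaseSpace
open scoped SchwartzMap

/-!
The proof reduces every assertion to one commutation relation. For `ε = ±1` and a phase space point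
`z = (x, p)` let `D_ε(z) ψ(u) = e^{(i/ħ) p·(u - x/2)} ψ(ε (u - x))`; these operators
(`displacement`) are the Heisenberg displacements for `ε = 1` and the Grossmann-Royer reflections
for `ε = -1`. The ambiguity function is the matrix coefficient `⟨D₁(z) ψ, ψ⟩` and the cross-Wigner
function of `f, g` the matrix coefficient `⟨D₋₁(2z) g, f⟩`, up to constants
(`ambiguity_eq_inner`, `crossWigner_eq_inner`). Since metaplectic operators are unitary, their
covariance follows from `Ŝ D_ε(z) = D_ε(S z) Ŝ`.

This relation is stable under products and inverses, so it is enough to have it for the generators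
`Ŝ_{𝒜,m}`, and by density on integrable functions. There it amounts to an identity between the
phases of two integral kernels (`IsFree.generatingFunction_translate`), which expresses that `𝒜`
generates `S`: if `S (x', p') = (x, p)`, then `p = ∂𝒜/∂x` and `p' = -∂𝒜/∂x'`.

A generator is, up to a constant factor, a composition of two multiplications by chirps,
a linear change of variables and the Fourier transform, hence an automorphism of the Schwartz space;
therefore so is every metaplectic operator (`exists_schwartz_of_mem_projectionGraph`). The extension
of `Ŝ` to tempered distributions is the transpose of the complex conjugate of `Ŝ†`. Finally
`⟨Op_W(a) ψ, φ⟩` is the value of `a` on the cross-Wigner function of `ψ` and `φ*`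
(`kernelTranspose_tensorCLM`), so that the covariance of Weyl operators is the covariance of
cross-Wigner functions (`crossWigner_covariant`) together with `det S = 1`.
-/

noncomputable section

namespace PhaseSpace
open MeasureTheory Complex Matrix
open scoped FourierTransform

/-! ### Free symplectic matrices and their generating functions -/

section GeneratingFunction

variable {n : ℕ}

theorem IsFree.isUnit_det {S : Sp n} (hS : IsFree S) : IsUnit S.1.toBlocks₁₂.det :=
  isUnit_iff_ne_zero.2 hS

theorem symplectic_block_relations (S : Sp n) :
    S.1.toBlocks₁₁ * S.1.toBlocks₁₂ᵀ = S.1.toBlocks₁₂ * S.1.toBlocks₁₁ᵀ ∧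
    S.1.toBlocks₁₂ᵀ * S.1.toBlocks₂₂ = S.1.toBlocks₂₂ᵀ * S.1.toBlocks₁₂ ∧
    S.1.toBlocks₁₁ * S.1.toBlocks₂₂ᵀ - S.1.toBlocks₁₂ * S.1.toBlocks₂₁ᵀ = 1 := by
  have h1 : fromBlocks S.1.toBlocks₁₁ S.1.toBlocks₁₂ S.1.toBlocks₂₁ S.1.toBlocks₂₂ ∈
      symplecticGroup (Fin n) ℝ := by rw [fromBlocks_toBlocks]; exact S.2
  have h2 := SymplecticGroup.transpose_mem h1
  rw [fromBlocks_transpose, SymplecticGroup.fromBlocks_mem_iff] at h2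
  rw [SymplecticGroup.fromBlocks_mem_iff] at h1
  simp only [transpose_transpose] at h1 h2
  exact ⟨h2.1, h1.2.1, h2.2.2⟩

theorem IsFree.isSymm_inv_mul {S : Sp n} (hS : IsFree S) :
    (S.1.toBlocks₁₂⁻¹ * S.1.toBlocks₁₁).IsSymm := by
  obtain ⟨h, -, -⟩ := symplectic_block_relations S
  have hu := hS.isUnit_det
  set A := S.1.toBlocks₁₁
  set B := S.1.toBlocks₁₂
  have hu' : IsUnit Bᵀ.det := by rwa [det_transpose]
  calc (B⁻¹ * A)ᵀ = B⁻¹ * (B * Aᵀ) * Bᵀ⁻¹ := by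
        rw [transpose_mul, transpose_nonsing_inv, nonsing_inv_mul_cancel_left _ _ hu]
    _ = B⁻¹ * A := by
        rw [← h, Matrix.mul_assoc, Matrix.mul_assoc, mul_nonsing_inv _ hu', Matrix.mul_one]

theorem IsFree.isSymm_mul_inv {S : Sp n} (hS : IsFree S) :
    (S.1.toBlocks₂₂ * S.1.toBlocks₁₂⁻¹).IsSymm := by
  obtain ⟨-, h, -⟩ := symplectic_block_relations S
  have hu := hS.isUnit_det
  set D := S.1.toBlocks₂₂
  set B := S.1.toBlocks₁₂
  have hu' : IsUnit Bᵀ.det := by rwa [det_transpose]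
  calc (D * B⁻¹)ᵀ = Bᵀ⁻¹ * (Dᵀ * B) * B⁻¹ := by
        rw [transpose_mul, transpose_nonsing_inv, Matrix.mul_assoc,
          mul_nonsing_inv_cancel_right _ _ hu]
    _ = D * B⁻¹ := by
        rw [← h, nonsing_inv_mul_cancel_left _ _ hu']

theorem IsFree.toBlocks₂₁_eq {S : Sp n} (hS : IsFree S) :
    S.1.toBlocks₂₁ = S.1.toBlocks₂₂ * S.1.toBlocks₁₂⁻¹ * S.1.toBlocks₁₁ -
      (S.1.toBlocks₁₂⁻¹)ᵀ := by
  obtain ⟨-, -, h⟩ := symplectic_block_relations S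
  have hN := hS.isSymm_inv_mul
  have hu := hS.isUnit_det
  set A := S.1.toBlocks₁₁
  set B := S.1.toBlocks₁₂
  set C := S.1.toBlocks₂₁
  set D := S.1.toBlocks₂₂
  have h1 : Cᵀ = B⁻¹ * A * Dᵀ - B⁻¹ := by
    have h' : B * Cᵀ = A * Dᵀ - 1 := by rw [← h, sub_sub_cancel]
    rw [← nonsing_inv_mul_cancel_left B Cᵀ hu, h', Matrix.mul_sub, Matrix.mul_one,
      Matrix.mul_assoc]
  rw [← transpose_transpose C, h1, transpose_sub, transpose_mul, hN.eq, transpose_transpose,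
    Matrix.mul_assoc]

theorem dotProduct_mulVec_comm_of_isSymm {M : Matrix (Fin n) (Fin n) ℝ} (hM : M.IsSymm)
    (u v : Fin n → ℝ) : (M *ᵥ u) ⬝ᵥ v = (M *ᵥ v) ⬝ᵥ u := by
  rw [dotProduct_comm, dotProduct_mulVec, ← mulVec_transpose, hM.eq]

/-- A free symplectic matrix maps `(a, p)` to `(b, q)` exactly when `p = B⁻¹ b - B⁻¹ A a` and
`q = D B⁻¹ b - B⁻ᵀ a`, that is `p = -∂𝒜/∂x'(b, a)` and `q = ∂𝒜/∂x(b, a)`. -/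
theorem IsFree.momentum_eq {S : Sp n} (hS : IsFree S) (z : Phase n) :
    z.2.ofLp = S.1.toBlocks₁₂⁻¹ *ᵥ (spEquiv S z).1.ofLp -
      (S.1.toBlocks₁₂⁻¹ * S.1.toBlocks₁₁) *ᵥ z.1.ofLp ∧
    (spEquiv S z).2.ofLp = (S.1.toBlocks₂₂ * S.1.toBlocks₁₂⁻¹) *ᵥ (spEquiv S z).1.ofLp -
      (S.1.toBlocks₁₂⁻¹)ᵀ *ᵥ z.1.ofLp := by
  have hu := hS.isUnit_det
  have h1 : (spEquiv S z).1.ofLp = S.1.toBlocks₁₁ *ᵥ z.1.ofLp + S.1.toBlocks₁₂ *ᵥ z.2.ofLp := rfl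
  have h2 : (spEquiv S z).2.ofLp = S.1.toBlocks₂₁ *ᵥ z.1.ofLp + S.1.toBlocks₂₂ *ᵥ z.2.ofLp := rfl
  constructor
  · rw [h1, mulVec_add, mulVec_mulVec, mulVec_mulVec, nonsing_inv_mul _ hu, one_mulVec]
    abel
  · rw [h2, h1, hS.toBlocks₂₁_eq, mulVec_add, mulVec_mulVec, mulVec_mulVec, sub_mulVec,
      nonsing_inv_mul_cancel_right _ _ hu]
    abel

theorem inner_config (u v : Config n) : inner ℝ u v = u.ofLp ⬝ᵥ v.ofLp := by
  rw [EuclideanSpace.inner_eq_star_dotProduct, star_trivial, dotProduct_comm]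

/-- How the generating function of a free symplectic matrix behaves under a phase space
translation, composed with the parity when `ε = -1`. This is the infinitesimal relation
`p = ∂𝒜/∂x`, `p' = -∂𝒜/∂x'` in integrated form. -/
theorem IsFree.generatingFunction_translate {S : Sp n} (hS : IsFree S) {ε : ℝ} (hε : ε * ε = 1)
    (z : Phase n) (x x' : Config n) :
    generatingFunction S x (ε • x' + z.1) + inner ℝ z.2 (ε • x' + (2⁻¹ : ℝ) • z.1) =
      inner ℝ (spEquiv S z).2 (x - (2⁻¹ : ℝ) • (spEquiv S z).1) +
        generatingFunction S (ε • (x - (spEquiv S z).1)) x' := by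
  obtain ⟨h1, h2⟩ := hS.momentum_eq z
  have hM := dotProduct_mulVec_comm_of_isSymm hS.isSymm_mul_inv
  have hN := dotProduct_mulVec_comm_of_isSymm hS.isSymm_inv_mul
  simp only [inner_config, generatingFunction, h1, h2, WithLp.ofLp_add, WithLp.ofLp_sub,
    WithLp.ofLp_smul]
  generalize S.1.toBlocks₂₂ * S.1.toBlocks₁₂⁻¹ = M at *
  generalize S.1.toBlocks₁₂⁻¹ * S.1.toBlocks₁₁ = N at *
  generalize S.1.toBlocks₁₂⁻¹ = L at *
  generalize z.1.ofLp = a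
  generalize (spEquiv S z).1.ofLp = b
  generalize x.ofLp = x
  generalize x'.ofLp = y
  have hL (u v : Fin n → ℝ) : (Lᵀ *ᵥ u) ⬝ᵥ v = (L *ᵥ v) ⬝ᵥ u := by
    rw [dotProduct_comm, dotProduct_mulVec, vecMul_transpose]
  simp only [mulVec_add, mulVec_sub, mulVec_smul, add_dotProduct, sub_dotProduct, smul_dotProduct,
    dotProduct_add, dotProduct_sub, dotProduct_smul, smul_eq_mul, hL, hM x b, hN y a]
  linear_combination
    (2⁻¹ * ((N *ᵥ y) ⬝ᵥ y) - 2⁻¹ * ((M *ᵥ x) ⬝ᵥ x) + (M *ᵥ b) ⬝ᵥ x - 2⁻¹ * ((M *ᵥ b) ⬝ᵥ b)) * hε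

end GeneratingFunction

/-! ### Displacement and reflection operators -/

section Displacement

variable {n : ℕ}

/-- The motion `y ↦ ε y + a` of `ℝⁿ`, where `ε = ±1`. -/
def signedTranslation {ε : ℝ} (hε : ε * ε = 1) (a : Config n) : Config n ≃ᵐ Config n where
  toFun y := ε • y + a
  invFun u := ε • (u - a)
  left_inv y := by simp only [add_sub_cancel_right, smul_smul, hε, one_smul]
  right_inv u := by simp only [smul_smul, hε, one_smul, sub_add_cancel]
  measurable_toFun := by
    change Measurable fun y : Config n ↦ ε • y + a
    fun_prop
  measurable_invFun := by
    change Measurable fun u : Config n ↦ ε • (u - a)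
    fun_prop

theorem measurePreserving_signedTranslation {ε : ℝ} (hε : ε * ε = 1) (a : Config n) :
    MeasurePreserving (signedTranslation hε a) := by
  change MeasurePreserving ((fun u : Config n ↦ u + a) ∘ fun y : Config n ↦ ε • y)
  refine (measurePreserving_add_right volume a).comp ?_
  rcases mul_self_eq_one_iff.1 hε with rfl | rfl
  · simp only [one_smul]
    exact MeasurePreserving.id volume
  · simp only [neg_one_smul]
    exact Measure.measurePreserving_neg (volume : Measure (Config n))

/-- The function `u ↦ e^{(i/ħ) p·(u - x/2)} f(ε (u - x))`, where `z = (x, p)`. -/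
def displace (ħ ε : ℝ) (z : Phase n) (f : Config n → ℂ) (u : Config n) : ℂ :=
  cexp (I / ħ * (inner ℝ z.2 (u - (2⁻¹ : ℝ) • z.1) : ℝ)) * f (ε • (u - z.1))

theorem norm_exp_I_div_mul (ħ t : ℝ) : ‖cexp (I / ħ * t)‖ = 1 := by
  rw [show I / ħ * t = ((t / ħ : ℝ) : ℂ) * I by push_cast; ring]
  exact norm_exp_ofReal_mul_I _

theorem norm_displace (ħ ε : ℝ) (z : Phase n) (f : Config n → ℂ) (u : Config n) :
    ‖displace ħ ε z f u‖ = ‖f (ε • (u - z.1))‖ := by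
  rw [displace, norm_mul, norm_exp_I_div_mul, one_mul]

theorem displace_congr_ae (ħ : ℝ) {ε : ℝ} (hε : ε * ε = 1) (z : Phase n) {f g : Config n → ℂ}
    (h : f =ᵐ[volume] g) : displace ħ ε z f =ᵐ[volume] displace ħ ε z g := by
  have := (measurePreserving_signedTranslation hε z.1).symm.quasiMeasurePreserving.ae_eq_comp h
  filter_upwards [this] with u hu
  exact congrArg (cexp (I / ħ * (inner ℝ z.2 (u - (2⁻¹ : ℝ) • z.1) : ℝ)) * ·) hu

theorem aestronglyMeasurable_displace (ħ : ℝ) {ε : ℝ} (hε : ε * ε = 1) (z : Phase n)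
    {f : Config n → ℂ} (hf : AEStronglyMeasurable f) : AEStronglyMeasurable (displace ħ ε z f) :=
  (Continuous.aestronglyMeasurable (by fun_prop)).mul
    (hf.comp_measurePreserving (measurePreserving_signedTranslation hε z.1).symm)

theorem eLpNorm_displace (ħ : ℝ) {ε : ℝ} (hε : ε * ε = 1) (z : Phase n) {f : Config n → ℂ}
    (hf : AEStronglyMeasurable f) (p : ENNReal) :
    eLpNorm (displace ħ ε z f) p = eLpNorm f p := by
  rw [← eLpNorm_comp_measurePreserving hf (measurePreserving_signedTranslation hε z.1).symm]
  exact eLpNorm_congr_norm_ae (Filter.Eventually.of_forall fun u ↦ norm_displace ..)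

theorem memLp_displace (ħ : ℝ) {ε : ℝ} (hε : ε * ε = 1) (z : Phase n) {f : Config n → ℂ}
    {p : ENNReal} (hf : MemLp f p) : MemLp (displace ħ ε z f) p :=
  ⟨aestronglyMeasurable_displace ħ hε z hf.1, (eLpNorm_displace ħ hε z hf.1 p).trans_lt hf.2⟩

/-- The unitary operator `ψ ↦ (u ↦ e^{(i/ħ) p·(u - x/2)} ψ(ε (u - x)))` on `L²(ℝⁿ)`, where
`z = (x, p)`. For `ε = 1` it is the Heisenberg displacement operator at `z`, for `ε = -1` the
Grossmann-Royer reflection operator at `z / 2`. -/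
def displacement (ħ : ℝ) {ε : ℝ} (hε : ε * ε = 1) (z : Phase n) : L2 n →ₗᵢ[ℂ] L2 n where
  toFun ψ := (memLp_displace ħ hε z (Lp.memLp ψ)).toLp
  map_add' ψ χ := by
    rw [← MemLp.toLp_add]
    refine MemLp.toLp_congr _ _ ((displace_congr_ae ħ hε z (Lp.coeFn_add ψ χ)).trans
      (Filter.Eventually.of_forall fun u ↦ mul_add _ _ _))
  map_smul' c ψ := by
    rw [RingHom.id_apply, ← MemLp.toLp_const_smul]
    refine MemLp.toLp_congr _ _ ((displace_congr_ae ħ hε z (Lp.coeFn_smul c ψ)).trans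
      (Filter.Eventually.of_forall fun u ↦ mul_left_comm _ _ _))
  norm_map' ψ := by
    change ‖(memLp_displace ħ hε z (Lp.memLp ψ)).toLp‖ = _
    rw [Lp.norm_toLp, eLpNorm_displace ħ hε z (Lp.aestronglyMeasurable ψ), Lp.norm_def]

theorem coeFn_displacement (ħ : ℝ) {ε : ℝ} (hε : ε * ε = 1) (z : Phase n) (ψ : L2 n) :
    displacement ħ hε z ψ =ᵐ[volume] displace ħ ε z ψ :=
  (memLp_displace ħ hε z (Lp.memLp ψ)).coeFn_toLp

/-- The generalized Fourier integral intertwines the displacements at `z` and at `S z`. -/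
theorem IsFree.generalizedFourier_displace {S : Sp n} (hS : IsFree S) (ħ : ℝ) {ε : ℝ}
    (hε : ε * ε = 1) (m : ℤ) (z : Phase n) (f : Config n → ℂ) (x : Config n) :
    generalizedFourier ħ S m (displace ħ ε z f) x =
      displace ħ ε (spEquiv S z) (generalizedFourier ħ S m f) x := by
  rw [displace, generalizedFourier, generalizedFourier, mul_left_comm]
  congr 1
  -- Substitute `x' = ε y + z.1`, which undoes the motion of the argument of `f`.
  rw [← (measurePreserving_signedTranslation hε z.1).integral_comp
    (signedTranslation hε z.1).measurableEmbedding, ← integral_const_mul]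
  refine integral_congr_ae (Filter.Eventually.of_forall fun y ↦ ?_)
  have h1 : ε • (signedTranslation hε z.1 y - z.1) = y :=
    (signedTranslation hε z.1).symm_apply_apply y
  have h2 : signedTranslation hε z.1 y - (2⁻¹ : ℝ) • z.1 = ε • y + (2⁻¹ : ℝ) • z.1 := by
    change ε • y + z.1 - (2⁻¹ : ℝ) • z.1 = _
    module
  have h3 := hS.generatingFunction_translate hε z x y
  simp only [displace, h1, h2]
  rw [← mul_assoc, ← mul_assoc, ← Complex.exp_add, ← Complex.exp_add, ← mul_add, ← mul_add,
    ← Complex.ofReal_add, ← Complex.ofReal_add, ← h3]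
  rfl

theorem IsGeneralizedFourier.map_displacement {ħ : ℝ} {S : Sp n} {m : ℤ} {U : UnitaryOp n}
    (hU : IsGeneralizedFourier ħ S m U) {ε : ℝ} (hε : ε * ε = 1) (z : Phase n) (ψ : L2 n) :
    U (displacement ħ hε z ψ) = displacement ħ hε (spEquiv S z) (U ψ) := by
  have hd := SchwartzMap.denseRange_toLpCLM (E := Config n) (F := ℂ) (p := 2)
    (μ := volume) (by norm_num)
  refine congrFun (hd.equalizer (g := fun ψ : L2 n ↦ U (displacement ħ hε z ψ))
    (h := fun ψ ↦ displacement ħ hε (spEquiv S z) (U ψ))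
    (U.continuous.comp (displacement ħ hε z).continuous)
    ((displacement ħ hε (spEquiv S z)).continuous.comp U.continuous) (funext fun φ ↦ ?_)) ψ
  simp only [Function.comp_apply, SchwartzMap.toLpCLM_apply]
  have hφ : Integrable (φ.toLp 2 : L2 n) := φ.integrable.congr (φ.coeFn_toLp 2).symm
  have hD : Integrable (displacement ħ hε z (φ.toLp 2)) :=
    (memLp_one_iff_integrable.1 (memLp_displace ħ hε z (memLp_one_iff_integrable.2 hφ))).congr
      (coeFn_displacement ħ hε z _).symm
  refine Lp.ext ?_
  have h1 := displace_congr_ae ħ hε (spEquiv S z) (hU.2.2 _ hφ)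
  filter_upwards [hU.2.2 _ hD, coeFn_displacement ħ hε (spEquiv S z) (U (φ.toLp 2)), h1]
    with x h2 h3 h4
  rw [h2, h3, h4, ← hU.1.generalizedFourier_displace ħ hε]
  refine congrArg (_ * ·) (integral_congr_ae ?_)
  filter_upwards [coeFn_displacement ħ hε z (φ.toLp 2)] with y hy
  rw [hy]

/-- Metaplectic operators intertwine the displacement and reflection operators. -/
theorem map_displacement_of_mem_projectionGraph {ħ : ℝ} {X : UnitaryOp n × Sp n}
    (hX : X ∈ projectionGraph ħ n) {ε : ℝ} (hε : ε * ε = 1) (z : Phase n) (ψ : L2 n) :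
    X.1 (displacement ħ hε z ψ) = displacement ħ hε (spEquiv X.2 z) (X.1 ψ) := by
  induction hX using Subgroup.closure_induction generalizing z ψ with
  | mem X hX => exact hX.choose_spec.map_displacement hε z ψ
  | one =>
    change displacement ħ hε z ψ = displacement ħ hε (blockAct 1 z) ψ
    rw [blockAct_one]
  | mul X Y _ _ ihX ihY =>
    change X.1 (Y.1 _) = displacement ħ hε (blockAct (X.2.1 * Y.2.1) z) (X.1 (Y.1 ψ))
    rw [ihY, ihX, blockAct_mul]
    rfl
  | inv X _ ih =>
    change X.1.symm _ = displacement ħ hε ((spEquiv X.2).symm z) (X.1.symm ψ)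
    rw [LinearIsometryEquiv.symm_apply_eq, ih, LinearIsometryEquiv.apply_symm_apply,
      ContinuousLinearEquiv.apply_symm_apply]

end Displacement

/-! ### Wigner and ambiguity functions as matrix coefficients -/

section MatrixCoefficients

variable {n : ℕ}

theorem inner_displacement (ħ : ℝ) {ε : ℝ} (hε : ε * ε = 1) (z : Phase n) (f g : L2 n) :
    inner ℂ (displacement ħ hε z g) f =
      ∫ u, f u * starRingEnd ℂ (displace ħ ε z g u) := by
  rw [L2.inner_def]
  refine integral_congr_ae ?_
  filter_upwards [coeFn_displacement ħ hε z g] with u hu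
  rw [hu]
  rfl

theorem conj_exp_I_div_mul (ħ t : ℝ) :
    starRingEnd ℂ (cexp (I / ħ * t)) = cexp (-(I / ħ) * t) := by
  rw [← Complex.exp_conj, map_mul, map_div₀, conj_I, conj_ofReal, conj_ofReal, neg_div]

theorem ambiguity_eq_inner (ħ : ℝ) (ψ : L2 n) (z : Phase n) :
    ambiguity ħ ψ z = (((1 / (2 * Real.pi * ħ)) ^ n : ℝ) : ℂ) *
      inner ℂ (displacement ħ (one_mul (1 : ℝ)) z ψ) ψ := by
  rw [ambiguity, inner_displacement,
    ← integral_add_right_eq_self (fun u ↦ ψ u * _) ((2⁻¹ : ℝ) • z.1)]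
  refine congrArg (_ * ·) (integral_congr_ae (Filter.Eventually.of_forall fun y ↦ ?_))
  have h : y + (2⁻¹ : ℝ) • z.1 - z.1 = y - (2⁻¹ : ℝ) • z.1 := by module
  simp only [displace, map_mul, conj_exp_I_div_mul, add_sub_cancel_right, one_smul, h]
  ring

/-- The cross-Wigner integral of `f` and `g` is a matrix coefficient of a reflection operator. -/
theorem crossWigner_eq_inner (ħ : ℝ) (f g : L2 n) (z : Phase n) :
    ∫ y : Config n, cexp (-(I / ħ) * (inner ℝ z.2 y : ℝ)) *
      (f (z.1 + (2⁻¹ : ℝ) • y) * starRingEnd ℂ (g (z.1 - (2⁻¹ : ℝ) • y))) =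
    2 ^ n * inner ℂ (displacement ħ (show (-1 : ℝ) * -1 = 1 by norm_num) ((2 : ℝ) • z) g) f := by
  rw [inner_displacement, ← integral_add_left_eq_self (fun u ↦ f u * _) z.1]
  -- The substitution `u = x + y / 2` produces the factor `2 ^ n`.
  have h := Measure.integral_comp_smul (volume : Measure (Config n)) (fun y ↦ f (z.1 + y) *
    starRingEnd ℂ (displace ħ (-1) ((2 : ℝ) • z) g (z.1 + y))) 2⁻¹
  have h2 : |((2⁻¹ : ℝ) ^ Module.finrank ℝ (Config n))⁻¹| = 2 ^ n := by
    rw [finrank_euclideanSpace_fin, inv_pow, inv_inv, abs_of_nonneg (by positivity)]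
  rw [h2, Complex.real_smul] at h
  push_cast at h
  rw [← h]
  refine integral_congr_ae (Filter.Eventually.of_forall fun y ↦ ?_)
  have h3 : (-1 : ℝ) • (z.1 + (2⁻¹ : ℝ) • y - (2 : ℝ) • z.1) = z.1 - (2⁻¹ : ℝ) • y := by module
  have h4 : z.1 + (2⁻¹ : ℝ) • y - (2⁻¹ : ℝ) • (2 : ℝ) • z.1 = (2⁻¹ : ℝ) • y := by module
  have h5 : (inner ℝ ((2 : ℝ) • z.2) ((2⁻¹ : ℝ) • y) : ℝ) = inner ℝ z.2 y := by
    rw [real_inner_smul_left, real_inner_smul_right, mul_inv_cancel_left₀ two_ne_zero]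
  simp only [displace, map_mul, conj_exp_I_div_mul, Prod.smul_fst, Prod.smul_snd, h3, h4, h5]
  ring

/-- Symplectic covariance of the cross-Wigner integral on `L²(ℝⁿ)`. -/
theorem crossWigner_covariant {ħ : ℝ} {X : UnitaryOp n × Sp n} (hX : X ∈ projectionGraph ħ n)
    (f g : L2 n) (z : Phase n) :
    ∫ y : Config n, cexp (-(I / ħ) * (inner ℝ (spEquiv X.2 z).2 y : ℝ)) *
      (X.1 f ((spEquiv X.2 z).1 + (2⁻¹ : ℝ) • y) *
        starRingEnd ℂ (X.1 g ((spEquiv X.2 z).1 - (2⁻¹ : ℝ) • y))) =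
    ∫ y : Config n, cexp (-(I / ħ) * (inner ℝ z.2 y : ℝ)) *
      (f (z.1 + (2⁻¹ : ℝ) • y) * starRingEnd ℂ (g (z.1 - (2⁻¹ : ℝ) • y))) := by
  rw [crossWigner_eq_inner, crossWigner_eq_inner, ← map_smul,
    ← map_displacement_of_mem_projectionGraph hX, LinearIsometryEquiv.inner_map_map]

theorem ambiguity_covariant {ħ : ℝ} {X : UnitaryOp n × Sp n} (hX : X ∈ projectionGraph ħ n)
    (ψ : L2 n) (z : Phase n) : ambiguity ħ (X.1 ψ) (spEquiv X.2 z) = ambiguity ħ ψ z := by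
  rw [ambiguity_eq_inner, ambiguity_eq_inner, ← map_displacement_of_mem_projectionGraph hX,
    LinearIsometryEquiv.inner_map_map]

end MatrixCoefficients

/-! ### Metaplectic operators on the Schwartz space -/

section SchwartzSpace

variable {n : ℕ}

theorem hasDerivAt_exp_I_mul_ofReal (c : ℂ) (t : ℝ) :
    HasDerivAt (fun t : ℝ ↦ c * cexp (I * t)) (c * I * cexp (I * t)) t := by
  have h := ((Complex.ofRealCLM.hasDerivAt (x := t)).const_mul I).cexp.const_mul c
  refine h.congr_deriv ?_
  simp only [Complex.ofRealCLM_apply, Complex.ofReal_one, mul_one]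
  ring

theorem iteratedDeriv_exp_I_mul_ofReal (k : ℕ) :
    iteratedDeriv k (fun t : ℝ ↦ cexp (I * t)) = fun t : ℝ ↦ I ^ k * cexp (I * t) := by
  induction k with
  | zero => simp
  | succ k ih =>
    rw [iteratedDeriv_succ, ih]
    funext t
    rw [(hasDerivAt_exp_I_mul_ofReal (I ^ k) t).deriv, pow_succ]

theorem hasTemperateGrowth_exp_I_mul_ofReal :
    (fun t : ℝ ↦ cexp (I * t)).HasTemperateGrowth := by
  refine ⟨(contDiff_const.mul Complex.ofRealCLM.contDiff).cexp, fun k ↦ ⟨0, 1, fun t ↦ ?_⟩⟩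
  rw [norm_iteratedFDeriv_eq_norm_iteratedDeriv, iteratedDeriv_exp_I_mul_ofReal, norm_mul,
    norm_pow, norm_I, one_pow, one_mul, mul_comm I, norm_exp_ofReal_mul_I, pow_zero, mul_one]

/-- The chirp `x ↦ e^{(i/2ħ) M x · x}`. -/
def chirp (ħ : ℝ) (M : Matrix (Fin n) (Fin n) ℝ) (x : Config n) : ℂ :=
  cexp (I / ħ * (2⁻¹ * ((M *ᵥ x.ofLp) ⬝ᵥ x.ofLp) : ℝ))

theorem hasTemperateGrowth_chirp (ħ : ℝ) (M : Matrix (Fin n) (Fin n) ℝ) :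
    (chirp ħ M).HasTemperateGrowth := by
  have h1 : (fun x : Config n ↦ (ħ⁻¹ * 2⁻¹) •
      innerSL ℝ (toEuclideanCLM (n := Fin n) (𝕜 := ℝ) M x) x).HasTemperateGrowth :=
    (Function.HasTemperateGrowth.const (ħ⁻¹ * 2⁻¹)).smul ((innerSL ℝ).bilinear_hasTemperateGrowth
      (toEuclideanCLM (n := Fin n) (𝕜 := ℝ) M).hasTemperateGrowth .id')
  convert hasTemperateGrowth_exp_I_mul_ofReal.comp h1 using 1
  funext x
  simp only [chirp, Function.comp_apply, innerSL_apply_apply, inner_config, ofLp_toEuclideanCLM,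
    smul_eq_mul]
  push_cast
  congr 1
  ring

theorem chirp_mul_chirp_neg (ħ : ℝ) (M : Matrix (Fin n) (Fin n) ℝ) (x : Config n) :
    chirp ħ M x * chirp ħ (-M) x = 1 := by
  rw [chirp, chirp, ← Complex.exp_add, neg_mulVec, neg_dotProduct, mul_neg, Complex.ofReal_neg,
    mul_neg, add_neg_cancel, Complex.exp_zero]

/-- Multiplication by a chirp, as an automorphism of the Schwartz space. -/
def chirpEquiv (ħ : ℝ) (M : Matrix (Fin n) (Fin n) ℝ) : 𝓢(Config n, ℂ) ≃L[ℂ] 𝓢(Config n, ℂ) :=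
  ContinuousLinearEquiv.equivOfInverse (SchwartzMap.smulLeftCLM ℂ (chirp ħ M))
    (SchwartzMap.smulLeftCLM ℂ (chirp ħ (-M)))
    (fun f ↦ by
      ext x
      rw [SchwartzMap.smulLeftCLM_apply_apply (hasTemperateGrowth_chirp ħ _),
        SchwartzMap.smulLeftCLM_apply_apply (hasTemperateGrowth_chirp ħ _), smul_smul, mul_comm,
        chirp_mul_chirp_neg, one_smul])
    (fun f ↦ by
      ext x
      rw [SchwartzMap.smulLeftCLM_apply_apply (hasTemperateGrowth_chirp ħ _),
        SchwartzMap.smulLeftCLM_apply_apply (hasTemperateGrowth_chirp ħ _), smul_smul,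
        chirp_mul_chirp_neg, one_smul])

theorem chirpEquiv_apply (ħ : ℝ) (M : Matrix (Fin n) (Fin n) ℝ) (f : 𝓢(Config n, ℂ))
    (x : Config n) : chirpEquiv ħ M f x = chirp ħ M x * f x :=
  SchwartzMap.smulLeftCLM_apply_apply (hasTemperateGrowth_chirp ħ _) f x

/-- The automorphism `x ↦ M x` of `ℝⁿ` defined by an invertible matrix. -/
def matrixEquiv (M : Matrix (Fin n) (Fin n) ℝ) (hM : IsUnit M.det) : Config n ≃L[ℝ] Config n :=
  ContinuousLinearEquiv.equivOfInverse (toEuclideanCLM (n := Fin n) (𝕜 := ℝ) M)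
    (toEuclideanCLM (n := Fin n) (𝕜 := ℝ) M⁻¹)
    (fun x ↦ by
      rw [← mul_apply_eq_comp, ← map_mul, nonsing_inv_mul _ hM, map_one]; rfl)
    (fun x ↦ by
      rw [← mul_apply_eq_comp, ← map_mul, mul_nonsing_inv _ hM, map_one]; rfl)

/-- Composition with a linear automorphism of `ℝⁿ`, as an automorphism of the Schwartz space. -/
def compEquiv (L : Config n ≃L[ℝ] Config n) : 𝓢(Config n, ℂ) ≃L[ℂ] 𝓢(Config n, ℂ) :=
  ContinuousLinearEquiv.equivOfInverse (SchwartzMap.compCLMOfContinuousLinearEquiv ℂ L)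
    (SchwartzMap.compCLMOfContinuousLinearEquiv ℂ L.symm)
    (fun f ↦ by ext x; exact congrArg f (L.apply_symm_apply x))
    (fun f ↦ by ext x; exact congrArg f (L.symm_apply_apply x))

/-- The generalized Fourier integral is, up to a constant factor, multiplication by a chirp,
followed by the Fourier transform, a linear change of variables and multiplication by another
chirp. In particular it is an automorphism of the Schwartz space. -/
theorem IsFree.exists_schwartz_generalizedFourier {S : Sp n} (hS : IsFree S) {ħ : ℝ} (hħ : 0 < ħ)
    (m : ℤ) : ∃ T : 𝓢(Config n, ℂ) ≃L[ℂ] 𝓢(Config n, ℂ),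
      ∀ f x, T f x = generalizedFourier ħ S m f x := by
  have hπ : 2 * Real.pi * ħ ≠ 0 := by positivity
  have hB : IsUnit S.1.toBlocks₁₂⁻¹.det := by
    rw [isUnit_nonsing_inv_det_iff]; exact hS.isUnit_det
  have hL : IsUnit ((2 * Real.pi * ħ)⁻¹ • S.1.toBlocks₁₂⁻¹).det := by
    rw [det_smul]
    exact (isUnit_iff_ne_zero.2 (pow_ne_zero _ (inv_ne_zero hπ))).mul hB
  set c : ℂ := (((1 / (2 * Real.pi * ħ)) ^ ((n : ℝ) / 2) : ℝ) : ℂ) *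
    I ^ ((m : ℂ) - (n : ℂ) / 2) * ((√|S.1.toBlocks₁₂⁻¹.det| : ℝ) : ℂ)
  have hc0 : c ≠ 0 := by
    refine mul_ne_zero (mul_ne_zero ?_ ?_) ?_
    · exact Complex.ofReal_ne_zero.2 (Real.rpow_pos_of_pos (by positivity) _).ne'
    · exact fun h ↦ I_ne_zero ((Complex.cpow_eq_zero_iff _ _).1 h).1
    · exact Complex.ofReal_ne_zero.2 (Real.sqrt_ne_zero'.2 (abs_pos.2 hB.ne_zero))
  refine ⟨(chirpEquiv ħ (S.1.toBlocks₁₂⁻¹ * S.1.toBlocks₁₁)).trans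
    ((FourierTransform.fourierCLE ℂ 𝓢(Config n, ℂ)).trans
    ((compEquiv (matrixEquiv _ hL)).trans
    ((chirpEquiv ħ (S.1.toBlocks₂₂ * S.1.toBlocks₁₂⁻¹)).trans
    (ContinuousLinearEquiv.smulLeft (Units.mk0 c hc0))))), fun f x ↦ ?_⟩
  change c * chirpEquiv _ _ _ x = c * _
  congr 1
  rw [chirpEquiv_apply]
  change _ * 𝓕 (chirpEquiv _ _ f) (matrixEquiv _ hL x) = _
  rw [SchwartzMap.fourier_coe, Real.fourier_eq', ← integral_const_mul]
  refine integral_congr_ae (Filter.Eventually.of_forall fun y ↦ ?_)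
  have hy : inner ℝ y (matrixEquiv _ hL x) =
      (2 * Real.pi * ħ)⁻¹ * ((S.1.toBlocks₁₂⁻¹ *ᵥ x.ofLp) ⬝ᵥ y.ofLp) := by
    rw [inner_config, dotProduct_comm]
    change ((_ • _) *ᵥ x.ofLp) ⬝ᵥ _ = _
    rw [smul_mulVec, smul_dotProduct, smul_eq_mul]
  change chirp _ _ x * (cexp _ • chirpEquiv _ _ f y) = cexp _ * f y
  rw [chirpEquiv_apply, smul_eq_mul, ← mul_assoc, ← mul_assoc, chirp, chirp, hy,
    ← Complex.exp_add, ← Complex.exp_add]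
  congr 2
  simp only [generatingFunction]
  have hħ' : (ħ : ℂ) ≠ 0 := by exact_mod_cast hħ.ne'
  have hπ' : (Real.pi : ℂ) ≠ 0 := by exact_mod_cast Real.pi_ne_zero
  push_cast
  field_simp
  ring

theorem IsGeneralizedFourier.coeFn_toLp {ħ : ℝ} {S : Sp n} {m : ℤ} {U : UnitaryOp n}
    (hU : IsGeneralizedFourier ħ S m U) (f : 𝓢(Config n, ℂ)) :
    U (f.toLp 2) =ᵐ[volume] generalizedFourier ħ S m f := by
  have hf : Integrable (f.toLp 2 : L2 n) := f.integrable.congr (f.coeFn_toLp 2).symm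
  refine (hU.2.2 _ hf).trans (Filter.Eventually.of_forall fun x ↦ ?_)
  refine congrArg (_ * ·) (integral_congr_ae ?_)
  filter_upwards [f.coeFn_toLp 2] with y hy
  rw [hy]

theorem IsGeneralizedFourier.exists_schwartz {ħ : ℝ} (hħ : 0 < ħ) {S : Sp n} {m : ℤ}
    {U : UnitaryOp n} (hU : IsGeneralizedFourier ħ S m U) :
    ∃ T : 𝓢(Config n, ℂ) ≃L[ℂ] 𝓢(Config n, ℂ), ∀ f, (T f).toLp 2 = U (f.toLp 2) := by
  obtain ⟨T, hT⟩ := hU.1.exists_schwartz_generalizedFourier hħ m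
  refine ⟨T, fun f ↦ Lp.ext ?_⟩
  filter_upwards [(T f).coeFn_toLp 2, hU.coeFn_toLp f] with x h1 h2
  rw [h1, h2, hT]

/-- Metaplectic operators restrict to automorphisms of the Schwartz space. -/
theorem exists_schwartz_of_mem_projectionGraph {ħ : ℝ} (hħ : 0 < ħ) {X : UnitaryOp n × Sp n}
    (hX : X ∈ projectionGraph ħ n) : ∃ T : 𝓢(Config n, ℂ) ≃L[ℂ] 𝓢(Config n, ℂ),
      ∀ f, (T f).toLp 2 = X.1 (f.toLp 2) := by
  induction hX using Subgroup.closure_induction with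
  | mem X hX => exact hX.choose_spec.exists_schwartz hħ
  | one => exact ⟨ContinuousLinearEquiv.refl _ _, fun f ↦ rfl⟩
  | mul X Y _ _ ihX ihY =>
    obtain ⟨T, hT⟩ := ihX
    obtain ⟨T', hT'⟩ := ihY
    refine ⟨T'.trans T, fun f ↦ ?_⟩
    change (T (T' f)).toLp 2 = X.1 (Y.1 _)
    rw [hT, hT']
  | inv X _ ih =>
    obtain ⟨T, hT⟩ := ih
    refine ⟨T.symm, fun f ↦ ?_⟩
    change _ = X.1.symm _
    rw [LinearIsometryEquiv.eq_symm_apply, ← hT, ContinuousLinearEquiv.apply_symm_apply]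

/-- Pointwise complex conjugation of Schwartz functions. -/
def conjSchwartz (n : ℕ) : 𝓢(Config n, ℂ) →L[ℝ] 𝓢(Config n, ℂ) :=
  SchwartzMap.postcompCLM (conjCLE : ℂ →L[ℝ] ℂ)

theorem conjSchwartz_apply (f : 𝓢(Config n, ℂ)) (x : Config n) :
    conjSchwartz n f x = starRingEnd ℂ (f x) := rfl

/-- The complex conjugate `f ↦ (T f*)*` of an operator `T` on the Schwartz space. When `T` restricts
the adjoint of an operator on `L²(ℝⁿ)`, this is its transpose for the bilinear pairing. -/
def conjOperator (T : 𝓢(Config n, ℂ) →L[ℂ] 𝓢(Config n, ℂ)) :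
    𝓢(Config n, ℂ) →L[ℂ] 𝓢(Config n, ℂ) where
  toFun f := conjSchwartz n (T (conjSchwartz n f))
  map_add' f g := by simp only [map_add]
  map_smul' c f := by
    have h (a : ℂ) (g : 𝓢(Config n, ℂ)) :
        conjSchwartz n (a • g) = starRingEnd ℂ a • conjSchwartz n g := by
      ext x
      exact map_mul (starRingEnd ℂ) a (g x)
    rw [h, map_smul, h, Complex.conj_conj, RingHom.id_apply]
  cont := (conjSchwartz n).continuous.comp (T.continuous.comp (conjSchwartz n).continuous)

theorem conjSchwartz_conjOperator (T : 𝓢(Config n, ℂ) →L[ℂ] 𝓢(Config n, ℂ))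
    (f : 𝓢(Config n, ℂ)) : conjSchwartz n (conjOperator T f) = T (conjSchwartz n f) := by
  ext x
  exact Complex.conj_conj _

theorem toTemperedDistribution_apply_eq_inner (u : L2 n) (f : 𝓢(Config n, ℂ)) :
    Lp.toTemperedDistribution u f = inner ℂ ((conjSchwartz n f).toLp 2 : L2 n) u := by
  rw [Lp.toTemperedDistribution_apply, L2.inner_def]
  refine integral_congr_ae ?_
  filter_upwards [(conjSchwartz n f).coeFn_toLp 2] with x hx
  rw [hx, conjSchwartz_apply, RCLike.inner_apply, Complex.conj_conj, smul_eq_mul, mul_comm]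

theorem isTemperedExtension_precomp_conjOperator (U : UnitaryOp n)
    {T : 𝓢(Config n, ℂ) →L[ℂ] 𝓢(Config n, ℂ)}
    (hT : ∀ f, (T f).toLp 2 = U.symm (f.toLp 2)) :
    IsTemperedExtension (U.toContinuousLinearEquiv : L2 n →L[ℂ] L2 n)
      (PointwiseConvergenceCLM.precomp ℂ (conjOperator T)) := by
  intro u
  ext f
  change Lp.toTemperedDistribution u (conjOperator T f) = Lp.toTemperedDistribution (U u) f
  rw [toTemperedDistribution_apply_eq_inner, toTemperedDistribution_apply_eq_inner,
    conjSchwartz_conjOperator, hT, ← U.inner_map_map, U.apply_symm_apply]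

end SchwartzSpace

/-! ### Weyl operators -/

section WeylOperators

variable {n : ℕ}

/-- The pairing of a Weyl operator with test functions is that of its symbol with a cross-Wigner
function. -/
theorem kernelTranspose_tensorCLM {ħ : ℝ} (hħ : 0 < ħ) (ψ φ : 𝓢(Config n, ℂ)) (z : Phase n) :
    kernelTranspose hħ (tensorCLM ψ φ) z = (((1 / (2 * Real.pi * ħ)) ^ n : ℝ) : ℂ) *
      ∫ y : Config n, cexp (-(I / ħ) * (inner ℝ z.2 y : ℝ)) *
        ((ψ.toLp 2 : L2 n) (z.1 + (2⁻¹ : ℝ) • y) *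
          starRingEnd ℂ (((conjSchwartz n φ).toLp 2 : L2 n) (z.1 - (2⁻¹ : ℝ) • y))) := by
  have hq (s : ℝ) (hs : s ≠ 0) : Measure.QuasiMeasurePreserving
      (fun y : Config n ↦ z.1 + s • y) := by
    refine (measurePreserving_add_left volume z.1).quasiMeasurePreserving.comp ?_
    exact ⟨by fun_prop, by
      rw [Measure.map_addHaar_smul _ hs]; exact Measure.smul_absolutelyContinuous⟩
  have h1 := (hq 2⁻¹ (by norm_num)).ae_eq_comp (ψ.coeFn_toLp 2)
  have h2 := (hq (-2⁻¹) (by norm_num)).ae_eq_comp ((conjSchwartz n φ).coeFn_toLp 2)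
  -- The substitution `y ↦ -y` turns the phase of the kernel into that of the Wigner function.
  rw [← Prod.mk.eta (p := z), kernelTranspose_apply, ← integral_neg_eq_self]
  refine congrArg (_ * ·) (integral_congr_ae ?_)
  filter_upwards [h1, h2] with y h3 h4
  have h5 : z.1 - (2⁻¹ : ℝ) • y = z.1 + (-2⁻¹ : ℝ) • y := by module
  simp only [Function.comp_apply] at h3 h4
  rw [h5, h3, h4, conjSchwartz_apply, Complex.conj_conj, tensorCLM_apply, mul_comm (ψ _), ← h5]
  simp only [smul_neg, sub_neg_eq_add, ← sub_eq_add_neg, inner_neg_right]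
  congr 2
  push_cast
  ring

theorem det_spEquiv (S : Sp n) :
    LinearMap.det ((spEquiv S).toLinearEquiv : Phase n →ₗ[ℝ] Phase n) = 1 := by
  let e : Phase n ≃ₗ[ℝ] (Fin n ⊕ Fin n → ℝ) :=
    ((WithLp.linearEquiv 2 ℝ (Fin n → ℝ)).prodCongr (WithLp.linearEquiv 2 ℝ (Fin n → ℝ))).trans
      (LinearEquiv.sumArrowLequivProdArrow (Fin n) (Fin n) ℝ ℝ).symm
  have h : (e : Phase n →ₗ[ℝ] _) ∘ₗ ((spEquiv S).toLinearEquiv : Phase n →ₗ[ℝ] Phase n) ∘ₗ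
      (e.symm : _ →ₗ[ℝ] Phase n) = toLin' S.1 := by
    refine LinearMap.ext fun v ↦ ?_
    rw [toLin'_apply]
    conv_rhs => rw [← S.1.fromBlocks_toBlocks, fromBlocks_mulVec]
    rfl
  rw [← LinearMap.det_conj _ e, h, LinearMap.det_toLin', SymplecticGroup.det_eq_one S.2]

end WeylOperators

end PhaseSpace

end

/-! ### Symplectic covariance -/

theorem mainTheorem5 (n : ℕ) (ħ : ℝ) (hħ : 0 < ħ) (U : Mp ħ n) (S : Sp n)
    (hUS : HasProjection U S) :
    (∀ (ψ : L2 n) (z : Phase n),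
      wigner ħ ψ (spEquiv S z) = wigner ħ (metaplecticCLM U⁻¹ ψ) z ∧
      ambiguity ħ ψ (spEquiv S z) = ambiguity ħ (metaplecticCLM U⁻¹ ψ) z) ∧
    (∃ (T : 𝓢(Config n, ℂ) →L[ℂ] 𝓢(Config n, ℂ))
        (T' : 𝓢'(Config n, ℂ) →L[ℂ] 𝓢'(Config n, ℂ)),
      IsSchwartzRestriction (ContinuousLinearMap.adjoint (metaplecticCLM U)) T ∧
      IsTemperedExtension (metaplecticCLM U) T' ∧
      ∀ a : 𝓢'(Phase n, ℂ),
        weylOp hħ (compLinear a (spEquiv S⁻¹)) = T' ∘L weylOp hħ a ∘L T) := by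
  have hsymm (ψ : L2 n) : metaplecticCLM U⁻¹ ψ = (U : UnitaryOp n).symm ψ := rfl
  constructor
  · intro ψ z
    have h (χ : L2 n) : (U : UnitaryOp n) ((U : UnitaryOp n).symm χ) = χ :=
      (U : UnitaryOp n).apply_symm_apply χ
    rw [hsymm]
    constructor
    · have := crossWigner_covariant hUS ((U : UnitaryOp n).symm ψ) ((U : UnitaryOp n).symm ψ) z
      rw [h] at this
      exact congrArg (_ * ·) this
    · simpa only [h] using ambiguity_covariant hUS ((U : UnitaryOp n).symm ψ) z
  · obtain ⟨T₀, hT₀⟩ := exists_schwartz_of_mem_projectionGraph hħ (inv_mem hUS)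
    -- `T` is the restriction of `U⁻¹`, which is the adjoint of `U`.
    let T : 𝓢(Config n, ℂ) →L[ℂ] 𝓢(Config n, ℂ) := T₀
    have hT (f : 𝓢(Config n, ℂ)) : (T f).toLp 2 = (U : UnitaryOp n).symm (f.toLp 2) := hT₀ f
    refine ⟨T, PointwiseConvergenceCLM.precomp ℂ (conjOperator T), ?_,
      isTemperedExtension_precomp_conjOperator (U : UnitaryOp n) hT, ?_⟩
    · intro φ
      rw [hT]
      exact (DFunLike.congr_fun (U : UnitaryOp n).adjoint_eq_symm _).symm
    · intro a
      ext ψ φ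
      have hcov : (SchwartzMap.compCLMOfContinuousLinearEquiv ℂ (spEquiv S))
          (kernelTranspose hħ (tensorCLM ψ φ)) =
          kernelTranspose hħ (tensorCLM (T ψ) (conjOperator T φ)) := by
        ext z
        change kernelTranspose hħ (tensorCLM ψ φ) (spEquiv S z) = _
        have := crossWigner_covariant hUS ((T ψ).toLp 2) ((T (conjSchwartz n φ)).toLp 2) z
        simp only [hT, LinearIsometryEquiv.apply_symm_apply] at this
        rw [kernelTranspose_tensorCLM, kernelTranspose_tensorCLM, conjSchwartz_conjOperator, hT,
          hT, this]
      -- Both sides are values of `a`, at test functions which agree by `hcov`.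
      change ((|LinearMap.det ((spEquiv S⁻¹).toLinearEquiv : Phase n →ₗ[ℝ] Phase n)|⁻¹ : ℝ) : ℂ) •
        a (SchwartzMap.compCLMOfContinuousLinearEquiv ℂ (spEquiv S⁻¹).symm
          (kernelTranspose hħ (tensorCLM ψ φ))) =
        a (kernelTranspose hħ (tensorCLM (T ψ) (conjOperator T φ)))
      have hS : (spEquiv S⁻¹).symm = spEquiv S := by
        refine ContinuousLinearEquiv.ext (funext fun z ↦ ?_)
        rw [ContinuousLinearEquiv.symm_apply_eq]
        exact ((spEquiv S).symm_apply_apply z).symm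
      rw [det_spEquiv, hS, hcov, abs_one, inv_one, Complex.ofReal_one, one_smul]
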